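/- Let $k$ be a field. An algebra over a commutative ring $B$ is a $B$-module with a $B$-bilinear product (not necessarily associative, commutative or unital). An ideal is a two-sided ideal that is a $B$-submodule; an algebra is *prime* (*semiprime*) if $IJ=0$ implies $I=0$ or $J=0$ (respectively $II=0$ implies $I=0$) for ideals $I,J$, and *simple* if its product is not zero and it has no ideals except $0$ and itself. The *centroid* $C(\mathcal A)$ of a $k$-algebra $\mathcal A$ is the $k$-algebra of all $\chi\in\operatorname{End}_k(\mathcal A)$ with $\chi(xy)=\chi(x)y=x\chi(y)$ for all $x,y$, and similarly over any field; $\mathcal A$ is *central* if the canonical map from the base field to the centroid is bijective. $\mathcal A$ is *pfgc* if $\mathcal A\neq 0$, $\mathcal A\mathcal A=\mathcal A$ and $\mathcal A$ is a finitely generated $C(\mathcal A)$-module (in that case $C(\mathcal A)$ is commutative). Let $\mathbf V$ be a variety of $k$-algebras, that is, the class of all $k$-algebras that satisfy a given set of identities in the free nonassociative algebra $k_{\mathrm{na}}[x_1,x_2,\dots]$. Assume that $\mathbf V$ is *homogeneous*: with every $f$, the ideal of all identities satisfied by all algebras in $\mathbf V$ contains every multihomogeneous component of $f$ (the part of $f$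 with given degree in each variable). A $\mathbf V$-algebra over an extension field $K$ of $k$ is a $K$-algebra that lies in $\mathbf V$ as a $k$-algebra. Assume axiom (S): for every field extension $K/k$, every finite dimensional semiprime $\mathbf V$-algebra over $K$ is a direct sum of simple $K$-algebras. Let $\mathbf X$ be a set of archetypes for $\mathbf V$, that is, a set of finite dimensional central simple $\mathbf V$-algebras over $k$ such that * (A1) if $K/k$ is an algebraically closed field extension and $\mathcal B$ is a finite dimensional central simple $\mathbf V$-algebra over $K$, then $\mathcal B\simeq_K \mathcal X\otimes_k K$ for some $\mathcal X\in\mathbf X$; * (A2) if $K/k$ is a field extension, $\mathcal X,\mathcal X'\in\mathbf X$ and $\mathcal X\otimes_k K\simeq_K\mathcal X'\otimes_k K$, then $\mathcal X=\mathcal X'$. For a $\mathbb Z/m$-grading $\Sigma$, $\mathcal A=\bigoplus_{\bar\imath\in\mathbb Z/m}\mathcal A_{\bar\imath}$ with $m\ge 1$ and $\mathcal A_{\bar\imath}\mathcal A_{\bar\jmath}\subseteq\mathcal A_{\bar\imath+\bar\jmath}$, the loop algebra is the $k$-subalgebra $L(\mathcal A,\Sigma)=\bigoplus_{i\in\mathbb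 Z}\mathcal A_{\bar\imath}\otimes z^i$ of $\mathcal A\otimes_k k[z^{\pm1}]$. An *$n$-step loop algebra based on $\mathcal A$* is the last term $\mathcal L_n$ of a sequence $\mathcal L_0=\mathcal A,\mathcal L_1,\dots,\mathcal L_n$ where, for $1\le p\le n$, $\mathcal L_p=L(\mathcal L_{p-1},\Sigma_p)$ for some $m_p\ge1$ and some $\mathbb Z/m_p$-grading $\Sigma_p$ of $\mathcal L_{p-1}$. The *absolute type* of a prime pfgc $\mathbf V$-algebra $\mathcal A$ is the element $t(\mathcal A)\in\mathbf X$ such that, for every algebraically closed extension $K$ of $k$ and every injective unital $k$-algebra homomorphism $C(\mathcal A)\to K$, $t(\mathcal A)$ is the unique $\mathcal X\in\mathbf X$ with $\mathcal A\otimes_{C(\mathcal A)}K\simeq_K\mathcal X\otimes_k K$. **Theorem (Permanence of type).** Let $n\ge 0$ and let $\mathcal L$ be an $n$-step loop algebra based on a prime pfgc $\mathbf V$-algebra $\mathcal A$ over $k$. Then $\mathcal L$ is a prime pfgc $\mathbf V$-algebra, the absolute types of $\mathcal A$ and of $\mathcal L$ exist and are unique, and $t(\mathcal L)=t(\mathcal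 A)$. -/

import Mathlib

open scoped TensorProduct LaurentPolynomial

universe u

/-! ## Nonassociative algebras -/

/-- A bundled (not necessarily associative, commutative or unital) algebra over the field `k`:
a `k`-vector space with a `k`-bilinear product. -/
structure NonAssocAlg (k : Type u) [Field k] where
  carrier : Type u
  [ring : NonUnitalNonAssocRing carrier]
  [module : Module k carrier]
  [isScalarTower : IsScalarTower k carrier carrier]
  [smulCommClass : SMulCommClass k carrier carrier]

instance (k : Type u) [Field k] : CoeSort (NonAssocAlg k) (Type u) := ⟨NonAssocAlg.carrier⟩

attribute [instance] NonAssocAlg.ring NonAssocAlg.module NonAssocAlg.isScalarTower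
  NonAssocAlg.smulCommClass

/-- `A ≃_K B`: the `K`-algebras `A` and `B` are isomorphic. -/
def AlgIso (K : Type*) [Semiring K] (A B : Type*) [NonUnitalNonAssocSemiring A] [Module K A]
    [NonUnitalNonAssocSemiring B] [Module K B] : Prop :=
  ∃ e : A ≃ₗ[K] B, ∀ x y : A, e (x * y) = e x * e y

section AlgebraNotions

variable (K : Type*) [CommRing K] (A : Type*) [NonUnitalNonAssocRing A] [Module K A]

/-- The submodule `I` is a (two-sided) ideal of the `K`-algebra `A`. -/
def IsAlgIdeal (I : Submodule K A) : Prop :=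
  ∀ x ∈ I, ∀ a : A, a * x ∈ I ∧ x * a ∈ I

/-- `A` is prime: `IJ = 0` implies `I = 0` or `J = 0`, for ideals `I`, `J`. -/
def IsPrimeAlg : Prop :=
  ∀ I J : Submodule K A, IsAlgIdeal K A I → IsAlgIdeal K A J →
    (∀ x ∈ I, ∀ y ∈ J, x * y = 0) → I = ⊥ ∨ J = ⊥

/-- `A` is semiprime: `II = 0` implies `I = 0`, for ideals `I`. -/
def IsSemiprimeAlg : Prop :=
  ∀ I : Submodule K A, IsAlgIdeal K A I → (∀ x ∈ I, ∀ y ∈ I, x * y = 0) → I = ⊥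

/-- `A` is simple: `AA ≠ 0` and the only ideals of `A` are `0` and `A`. -/
def IsSimpleAlg : Prop :=
  (∃ x y : A, x * y ≠ 0) ∧ ∀ I : Submodule K A, IsAlgIdeal K A I → I = ⊥ ∨ I = ⊤

/-- `A` is perfect: `AA = A`. -/
def IsPerfectAlg : Prop :=
  Submodule.span K {z : A | ∃ x y : A, z = x * y} = ⊤

variable [IsScalarTower K A A] [SMulCommClass K A A]

/-- The centroid of `A`: the `K`-linear maps `χ : A → A` with
`χ(xy) = χ(x)y = xχ(y)` for all `x, y`. -/
def algCentroid : Subalgebra K (Module.End K A) where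
  carrier := {χ | ∀ x y : A, χ (x * y) = χ x * y ∧ χ (x * y) = x * χ y}
  mul_mem' := by
    intro f g hf hg x y
    refine ⟨?_, ?_⟩
    · simp only [Module.End.mul_apply]
      rw [(hg x y).1, (hf _ y).1]
    · simp only [Module.End.mul_apply]
      rw [(hg x y).2, (hf x _).2]
  add_mem' := by
    intro f g hf hg x y
    refine ⟨?_, ?_⟩
    · simp only [LinearMap.add_apply]
      rw [(hf x y).1, (hg x y).1, add_mul]
    · simp only [LinearMap.add_apply]
      rw [(hf x y).2, (hg x y).2, mul_add]
  algebraMap_mem' := by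
    intro r x y
    simp only [Module.algebraMap_end_apply]
    exact ⟨(smul_mul_assoc r x y).symm, (mul_smul_comm r x y).symm⟩

theorem algCentroid_smul_def (χ : algCentroid K A) (x : A) : χ • x = χ.1 x := rfl

/-- `A` is central over `K`: the canonical map from `K` to the centroid is an isomorphism. -/
def IsCentralAlg : Prop :=
  Function.Bijective (algebraMap K (algCentroid K A))

/-- `A` is pfgc: nonzero, perfect, and finitely generated as a module over its centroid. -/
class IsPfgc : Prop where
  nontrivial : Nontrivial A
  perfect : IsPerfectAlg K A
  finite : Module.Finite (algCentroid K A) A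

variable {K A} in
/-- The centroid of a perfect algebra is commutative. -/
theorem algCentroid_mul_comm (h : IsPerfectAlg K A) (χ ψ : algCentroid K A) :
    χ * ψ = ψ * χ := by
  apply Subtype.ext
  refine LinearMap.ext_on h ?_
  rintro _ ⟨x, y, rfl⟩
  change χ.1 (ψ.1 (x * y)) = ψ.1 (χ.1 (x * y))
  rw [(ψ.2 x y).1, (χ.2 _ y).2, (χ.2 x y).2, (ψ.2 x _).1]

/-- The (commutative) centroid of a pfgc algebra, as a ring. -/
instance algCentroid.instCommRing [IsPfgc K A] : CommRing (algCentroid K A) :=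
  { (inferInstance : Ring (algCentroid K A)) with
    mul_comm := algCentroid_mul_comm IsPfgc.perfect }

/-- The product of `A` is bilinear over the centroid (first variable). -/
instance algCentroid.instIsScalarTower : IsScalarTower (algCentroid K A) A A :=
  ⟨fun χ x y => ((χ.2 x y).1).symm⟩

/-- The product of `A` is bilinear over the centroid (second variable). -/
instance algCentroid.instSMulCommClass : SMulCommClass (algCentroid K A) A A :=
  ⟨fun χ x y => (χ.2 x y).2⟩

end AlgebraNotions

/-! ## Varieties -/

section Varieties

variable (k : Type u) [Field k]

/-- The algebra `A` satisfies the identity `f`, an element of the free nonassociative algebra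
over `k` on countably many symbols `x_0, x_1, …`. -/
def SatisfiesIdentity (f : FreeNonUnitalNonAssocAlgebra k ℕ) (A : Type*)
    [NonUnitalNonAssocRing A] [Module k A] [IsScalarTower k A A] [SMulCommClass k A A] : Prop :=
  ∀ v : ℕ → A, FreeNonUnitalNonAssocAlgebra.lift k v f = 0

variable {k} in
/-- `A` belongs to the variety `V` of `k`-algebras defined by the set `V` of identities. -/
def IsVAlg (V : Set (FreeNonUnitalNonAssocAlgebra k ℕ)) (A : Type*)
    [NonUnitalNonAssocRing A] [Module k A] [IsScalarTower k A A] [SMulCommClass k A A] : Prop :=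
  ∀ f ∈ V, SatisfiesIdentity k f A

variable {k} in
/-- The set (an ideal) of all identities that hold in all algebras of the variety `V`. -/
def identitiesOf (V : Set (FreeNonUnitalNonAssocAlgebra k ℕ)) :
    Set (FreeNonUnitalNonAssocAlgebra k ℕ) :=
  {f | ∀ A : NonAssocAlg k, IsVAlg V A → SatisfiesIdentity k f A}

/-- The type of a nonassociative monomial: its degree in each of the symbols. -/
noncomputable def monomialType : FreeMagma ℕ → (ℕ →₀ ℕ)
  | .of i => Finsupp.single i 1
  | .mul a b => monomialType a + monomialType b

variable {k} in
/-- The homogeneous component of `f` of type `d`: the part of `f` supported on the monomials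
whose degree in `x_i` is `d i` for every `i`. -/
noncomputable def homogeneousPart (d : ℕ →₀ ℕ) (f : FreeNonUnitalNonAssocAlgebra k ℕ) :
    FreeNonUnitalNonAssocAlgebra k ℕ :=
  MonoidAlgebra.ofCoeff (f.coeff.filter fun w => monomialType w = d)

variable {k} in
/-- The variety `V` is homogeneous: its ideal of identities contains, with each element, all
the homogeneous components of that element. -/
def IsHomogeneousVariety (V : Set (FreeNonUnitalNonAssocAlgebra k ℕ)) : Prop :=
  ∀ f ∈ identitiesOf V, ∀ d : ℕ →₀ ℕ, homogeneousPart d f ∈ identitiesOf V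

/-- `A` is a (finite) direct sum of simple algebras over `K`. -/
def IsDirectSumOfSimple (K : Type u) [Field K] (A : Type u) [NonUnitalNonAssocRing A]
    [Module K A] : Prop :=
  ∃ (r : ℕ) (S : Fin r → NonAssocAlg K),
    (∀ i, IsSimpleAlg K (S i)) ∧ AlgIso K A (∀ i, S i)

variable {k} in
/-- Axiom (S): if `K/k` is a field extension, every finite dimensional semiprime `V`-algebra
over `K` is a direct sum of simple algebras over `K`. -/
def AxiomS (V : Set (FreeNonUnitalNonAssocAlgebra k ℕ)) : Prop :=
  ∀ (K : Type u) [Field K] [Algebra k K] (A : Type u) [NonUnitalNonAssocRing A]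
    [Module K A] [IsScalarTower K A A] [SMulCommClass K A A]
    [Module k A] [IsScalarTower k A A] [SMulCommClass k A A] [IsScalarTower k K A],
    IsVAlg V A → Module.Finite K A → IsSemiprimeAlg K A → IsDirectSumOfSimple K A

variable {k} in
/-- `𝕏` is a set of archetypes for the variety `V`. -/
structure IsArchetypeSet (V : Set (FreeNonUnitalNonAssocAlgebra k ℕ))
    (𝕏 : Set (NonAssocAlg k)) : Prop where
  finite : ∀ X ∈ 𝕏, Module.Finite k X
  central : ∀ X ∈ 𝕏, IsCentralAlg k X
  simple : ∀ X ∈ 𝕏, IsSimpleAlg k X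
  isVAlg : ∀ X ∈ 𝕏, IsVAlg V X
  /-- Every finite dimensional central simple `V`-algebra over an algebraically closed
  extension of `k` is obtained from an archetype by base change. -/
  exists_iso : ∀ (K : Type u) [Field K] [IsAlgClosed K] [Algebra k K]
    (A : Type u) [NonUnitalNonAssocRing A]
    [Module K A] [IsScalarTower K A A] [SMulCommClass K A A]
    [Module k A] [IsScalarTower k A A] [SMulCommClass k A A] [IsScalarTower k K A],
    IsVAlg V A → Module.Finite K A → IsCentralAlg K A → IsSimpleAlg K A →
      ∃ X ∈ 𝕏, AlgIso K A (K ⊗[k] X)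
  /-- Archetypes that become isomorphic over an extension of `k` are equal. -/
  eq_of_iso : ∀ (K : Type u) [Field K] [Algebra k K], ∀ X ∈ 𝕏, ∀ X' ∈ 𝕏,
    AlgIso K (K ⊗[k] X) (K ⊗[k] X') → X = X'

end Varieties

/-! ## Iterated loop algebras -/

section Loop

variable {k : Type u} [Field k]

/-- `G` is a `ℤ/m`-grading of the algebra `A`. -/
def IsAlgGrading {m : ℕ} {A : Type*} [NonUnitalNonAssocRing A] [Module k A]
    (G : ZMod m → Submodule k A) : Prop :=
  DirectSum.IsInternal G ∧ ∀ i j, ∀ x ∈ G i, ∀ y ∈ G j, x * y ∈ G (i + j)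

/-- The underlying subspace `∑_i A_i ⊗ zⁱ` of the loop algebra, in `A ⊗ k[z, z⁻¹]`. -/
noncomputable def loopSubmodule {m : ℕ} {A : Type*} [NonUnitalNonAssocRing A] [Module k A]
    (G : ZMod m → Submodule k A) : Submodule k (A ⊗[k] k[T;T⁻¹]) :=
  ⨆ i : ℤ, (G (i : ZMod m)).map ((TensorProduct.mk k A k[T;T⁻¹]).flip (LaurentPolynomial.T i))

theorem loopSubmodule_mul_mem {m : ℕ} {A : Type*} [NonUnitalNonAssocRing A] [Module k A]
    [IsScalarTower k A A] [SMulCommClass k A A]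
    {G : ZMod m → Submodule k A} (hG : IsAlgGrading G) {x y : A ⊗[k] k[T;T⁻¹]}
    (hx : x ∈ loopSubmodule G) (hy : y ∈ loopSubmodule G) : x * y ∈ loopSubmodule G := by
  unfold loopSubmodule at hx
  induction hx using Submodule.iSup_induction' with
  | zero => rw [zero_mul]; exact Submodule.zero_mem _
  | add a b _ _ ha hb => rw [add_mul]; exact Submodule.add_mem _ ha hb
  | mem i a ha =>
    unfold loopSubmodule at hy
    induction hy using Submodule.iSup_induction' with
    | zero => rw [mul_zero]; exact Submodule.zero_mem _
    | add c d _ _ hc hd => rw [mul_add]; exact Submodule.add_mem _ hc hd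
    | mem j b hb =>
      obtain ⟨a, ha, rfl⟩ := ha
      obtain ⟨b, hb, rfl⟩ := hb
      refine Submodule.mem_iSup_of_mem (i + j) ⟨a * b, ?_, ?_⟩
      · have := hG.2 _ _ a ha b hb
        rwa [← Int.cast_add] at this
      · simp only [LinearMap.flip_apply, TensorProduct.mk_apply,
          Algebra.TensorProduct.tmul_mul_tmul, LaurentPolynomial.T_add]

/-- The loop algebra `⊕_i A_i ⊗ zⁱ`, the sum over all integers `i` (taken modulo `m` in `A_i`), a `k`-subalgebra of `A ⊗ k[z, z⁻¹]`. -/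
noncomputable def loopSubalgebra {m : ℕ} {A : Type*} [NonUnitalNonAssocRing A] [Module k A]
    [IsScalarTower k A A] [SMulCommClass k A A]
    (G : ZMod m → Submodule k A) (hG : IsAlgGrading G) :
    NonUnitalSubalgebra k (A ⊗[k] k[T;T⁻¹]) :=
  { loopSubmodule G with mul_mem' := fun hx hy => loopSubmodule_mul_mem hG hx hy }

/-- The loop algebra as a bundled `k`-algebra. -/
noncomputable def loopAlgebra (A : NonAssocAlg k) {m : ℕ} (G : ZMod m → Submodule k A)
    (hG : IsAlgGrading G) : NonAssocAlg k where
  carrier := loopSubalgebra G hG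

/-- `IsIteratedLoopAlgebra n A L`: `L` is an `n`-step loop algebra based on `A`. Each step takes
the loop algebra of a grading by `ℤ/m`, `m > 0`, of the algebra obtained so far. -/
inductive IsIteratedLoopAlgebra : ℕ → NonAssocAlg k → NonAssocAlg k → Prop
  | zero (A : NonAssocAlg k) : IsIteratedLoopAlgebra 0 A A
  | succ {n : ℕ} {A L : NonAssocAlg k} (h : IsIteratedLoopAlgebra n A L)
      {m : ℕ} (hm : 0 < m) (G : ZMod m → Submodule k L) (hG : IsAlgGrading G) :
      IsIteratedLoopAlgebra (n + 1) A (loopAlgebra L G hG)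

end Loop

/-! ## The absolute type -/

section AbsoluteType

variable {k : Type u} [Field k]

/-- `X` is the absolute type of the pfgc algebra `A` relative to `𝕏`: for every algebraically
closed extension `K` of `k` and every injective `k`-algebra homomorphism `C(A) → K`, `X` is the
unique element of `𝕏` whose base change to `K` is isomorphic to `K ⊗_{C(A)} A`. -/
def IsAbsoluteType (𝕏 : Set (NonAssocAlg k)) (A : NonAssocAlg k) [IsPfgc k A]
    (X : NonAssocAlg k) : Prop :=
  X ∈ 𝕏 ∧ ∀ (K : Type u) [Field K] [IsAlgClosed K] [Algebra k K]
    [Algebra (algCentroid k A) K] [IsScalarTower k (algCentroid k A) K],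
    Function.Injective (algebraMap (algCentroid k A) K) →
      ∀ Y ∈ 𝕏, AlgIso K (K ⊗[algCentroid k A] A) (K ⊗[k] Y) ↔ Y = X

end AbsoluteType

/-! Let `A` be prime pfgc with centroid `Z`. Kernels and images of centroid elements are mutually
annihilating ideals, so `Z` is a domain and `A` is torsion free over it. Put `F = Frac Z`. Clearing
denominators, `F ⊗[Z] A` is prime, central and finite dimensional; homogeneity of the variety keeps
it in `V`. Axiom (S) splits it into simple summands, and primeness leaves only one. By Jacobson
density the multiplication algebra of a finite dimensional central simple algebra is the full
endomorphism algebra, so central simplicity survives field extension: `K ⊗[Z] A` is central simple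
for every field `K` containing `Z`. An archetype found over the algebraic closure of `F` works over
every algebraically closed `K`, because that closure embeds in `K`; (A2) makes it unique
(`IsPrimeAlg.exists_archetype`, `isAbsoluteType_iff_eq`).

For one loop step, take `K` algebraically closed over `F(z)` with `z` transcendental, and evaluate
the Laurent variable at `z`. This maps the loop algebra `L` to `B = K ⊗[Z] A`. The map is injective
because the powers of `z` are independent over `F`, and its image spans `B` because `z` is
invertible (`exists_loopSubalgebra_embedding`). A spanning subalgebra of a central simple algebra is
prime, and its centroid acts on `B` by scalars, which embeds `C(L)` in `K`. The induced map `K ⊗ L →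
B` over `C(L)` is surjective with simple source, hence an isomorphism. Both types are thus read off
from the same `B` over the same `K` (`absoluteType_of_span_eq_top`). The centroid of `L` never has
to be computed: for pfgc it suffices to exhibit enough centroid elements, namely the graded
components of elements of `Z` times powers of `z`. -/

open scoped nonZeroDivisors

/-! ### Identities and scalar extension in a homogeneous variety -/

section VarietyLemmas

variable {k : Type u} [Field k]

/-- Evaluations of free algebra elements are carried along by algebra maps. -/
theorem map_freeLift {A B : Type*} [NonUnitalNonAssocRing A] [Module k A] [IsScalarTower k A A]
    [SMulCommClass k A A] [NonUnitalNonAssocRing B] [Module k B] [IsScalarTower k B B]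
    [SMulCommClass k B B] (φ : A →ₙₐ[k] B) (v : ℕ → A) (f : FreeNonUnitalNonAssocAlgebra k ℕ) :
    φ (FreeNonUnitalNonAssocAlgebra.lift k v f) =
      FreeNonUnitalNonAssocAlgebra.lift k (fun i => φ (v i)) f := by
  have h : φ.comp (FreeNonUnitalNonAssocAlgebra.lift k v) =
      FreeNonUnitalNonAssocAlgebra.lift k (fun i => φ (v i)) := by
    apply FreeNonUnitalNonAssocAlgebra.hom_ext
    intro i
    simp
  exact DFunLike.congr_fun h f

theorem IsVAlg.of_injective {V : Set (FreeNonUnitalNonAssocAlgebra k ℕ)} {A B : Type*}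
    [NonUnitalNonAssocRing A] [Module k A] [IsScalarTower k A A]
    [SMulCommClass k A A] [NonUnitalNonAssocRing B] [Module k B] [IsScalarTower k B B]
    [SMulCommClass k B B] (φ : A →ₙₐ[k] B) (hφ : Function.Injective φ) (hB : IsVAlg V B) :
    IsVAlg V A := by
  intro f hf v
  apply hφ
  rw [map_freeLift, hB f hf, map_zero]

/-- Rescaling each variable of a nonassociative monomial rescales its value. -/
theorem freeLift_monomial_smul {K A B : Type*} [CommRing K]
    [NonUnitalNonAssocRing A] [Module k A] [IsScalarTower k A A]
    [SMulCommClass k A A] [NonUnitalNonAssocRing B] [Module k B] [IsScalarTower k B B]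
    [SMulCommClass k B B] [Module K B] [IsScalarTower K B B] [SMulCommClass K B B]
    (φ : A →ₙₐ[k] B) (c : ℕ → K) (a : ℕ → A) (w : FreeMagma ℕ) :
    FreeMagma.lift (fun i => c i • φ (a i)) w =
      ((monomialType w).prod fun i n => c i ^ n) • φ (FreeMagma.lift a w) := by
  induction w with
  | ih1 i => simp [monomialType]
  | ih2 x y hx hy =>
    simp only [map_mul]
    rw [hx, hy]
    simp only [monomialType]
    rw [Finsupp.prod_add_index' (by simp) (by intros; rw [pow_add]), smul_mul_assoc,
      mul_smul_comm, smul_smul]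

theorem freeLift_eq_sum {A : Type*}
    [NonUnitalNonAssocRing A] [Module k A] [IsScalarTower k A A]
    [SMulCommClass k A A] (a : ℕ → A) (g : FreeNonUnitalNonAssocAlgebra k ℕ) :
    FreeNonUnitalNonAssocAlgebra.lift k a g = g.coeff.sum fun w r => r • FreeMagma.lift a w := rfl

/-- The factor produced by rescaling the variables depends only on the multidegree of a monomial, so
the monomials can be grouped by multidegree. -/
theorem freeLift_smul_eq_sum_homogeneousPart {K A B : Type*} [CommRing K] [Algebra k K]
    [NonUnitalNonAssocRing A] [Module k A] [IsScalarTower k A A]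
    [SMulCommClass k A A] [NonUnitalNonAssocRing B] [Module k B] [IsScalarTower k B B]
    [SMulCommClass k B B] [Module K B] [IsScalarTower K B B] [SMulCommClass K B B]
    [IsScalarTower k K B]
    (φ : A →ₙₐ[k] B) (c : ℕ → K) (a : ℕ → A) (g : FreeNonUnitalNonAssocAlgebra k ℕ) :
    FreeNonUnitalNonAssocAlgebra.lift k (fun i => c i • φ (a i)) g =
      ∑ d ∈ g.coeff.support.image monomialType, (d.prod fun i n => c i ^ n) •
        φ (FreeNonUnitalNonAssocAlgebra.lift k a (homogeneousPart d g)) := by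
  classical
  have : SMulCommClass k K B := IsScalarTower.to_smulCommClass
  rw [freeLift_eq_sum, Finsupp.sum,
    ← Finset.sum_fiberwise_of_maps_to (g := monomialType)
      (fun w hw => Finset.mem_image_of_mem _ hw)]
  refine Finset.sum_congr rfl fun d _ => ?_
  rw [freeLift_eq_sum]
  simp only [homogeneousPart, Finsupp.sum, Finsupp.support_filter, map_sum, Finset.smul_sum,
    map_smul]
  refine Finset.sum_congr rfl fun w hw => ?_
  rw [Finset.mem_filter] at hw
  rw [Finsupp.filter_apply_pos (fun w => monomialType w = d) _ hw.2, freeLift_monomial_smul,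
    hw.2, smul_comm]

/-- Scalar extensions of algebras in a homogeneous variety are in the variety. -/
theorem IsVAlg.of_span_eq_top {V : Set (FreeNonUnitalNonAssocAlgebra k ℕ)}
    (hV : IsHomogeneousVariety V) {A : Type u} {K B : Type*} [CommRing K] [Algebra k K]
    [NonUnitalNonAssocRing A] [Module k A] [IsScalarTower k A A]
    [SMulCommClass k A A] [NonUnitalNonAssocRing B] [Module k B] [IsScalarTower k B B]
    [SMulCommClass k B B] [Module K B] [IsScalarTower K B B] [SMulCommClass K B B]
    [IsScalarTower k K B] (φ : A →ₙₐ[k] B) (hA : IsVAlg V A)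
    (hspan : Submodule.span K (Set.range φ) = ⊤) : IsVAlg V B := by
  intro f hf v
  have hrep : ∀ b : B, ∃ (n : ℕ) (c : ℕ → K) (a : ℕ → A),
      b = ∑ j ∈ Finset.range n, c j • φ (a j) := by
    intro b
    have hb : b ∈ Submodule.span K (Set.range φ) := hspan ▸ Submodule.mem_top
    rw [Submodule.mem_span_set'] at hb
    obtain ⟨n, c, g, rfl⟩ := hb
    choose a ha using fun i => (g i).2
    refine ⟨n, fun j => if h : j < n then c ⟨j, h⟩ else 0,
      fun j => if h : j < n then a ⟨j, h⟩ else 0, ?_⟩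
    rw [Finset.sum_range]
    exact Finset.sum_congr rfl fun i _ => by simp [ha]
  choose n c a hv using fun i => hrep (v i)
  -- Each `v i` is a combination of images of `A`. Substituting a sum of fresh variables, numbered
  -- by `Nat.pair i j`, for `x_i` turns `f` into an identity `g` that is evaluated only at scalar
  -- multiples of elements of `A`; homogeneity then kills each multidegree of `g` separately.
  let c' : ℕ → K := fun p => c p.unpair.1 p.unpair.2
  let a' : ℕ → A := fun p => a p.unpair.1 p.unpair.2
  let s : ℕ → FreeNonUnitalNonAssocAlgebra k ℕ := fun i =>
    ∑ j ∈ Finset.range (n i), FreeNonUnitalNonAssocAlgebra.of k (Nat.pair i j)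
  let g := FreeNonUnitalNonAssocAlgebra.lift k s f
  have hfid : f ∈ identitiesOf V := fun A' hA' => hA' f hf
  have hg : g ∈ identitiesOf V := by
    intro A' hA' x
    rw [map_freeLift]
    exact hfid A' hA' _
  have h1 : FreeNonUnitalNonAssocAlgebra.lift k v f =
      FreeNonUnitalNonAssocAlgebra.lift k (fun p => c' p • φ (a' p)) g := by
    rw [map_freeLift]
    congr 2
    funext i
    simp [s, c', a', map_sum, ← hv]
  rw [h1, freeLift_smul_eq_sum_homogeneousPart]
  refine Finset.sum_eq_zero fun d _ => ?_
  rw [hV g hg d ⟨A⟩ hA a', map_zero, smul_zero]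

end VarietyLemmas

/-! ### Coordinates and rank-one maps after base change -/

section LinearAlgebraLemmas

variable {F K M : Type*} [Field F] [Field K] [Algebra F K] [AddCommGroup M] [Module F M]

theorem exists_rid_lTensor_ne_zero [Module.Finite F M] {x : K ⊗[F] M} (hx : x ≠ 0) :
    ∃ f : M →ₗ[F] F, TensorProduct.rid F K (f.lTensor K x) ≠ 0 := by
  let b := Module.finBasis F M
  by_contra! h
  apply hx
  apply (b.baseChange K).repr.injective
  rw [map_zero]
  ext i
  have h1 := h (b.coord i)
  have h2 : ∀ y : K ⊗[F] M, (b.baseChange K).repr y i =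
      TensorProduct.rid F K ((b.coord i).lTensor K y) := by
    intro y
    induction y with
    | zero => simp
    | add y z hy hz => simp [hy, hz]
    | tmul c y => simp [Module.Basis.baseChange, Algebra.smul_def, mul_comm]
  rw [h2, h1]
  rfl

theorem baseChange_smulRight (f : M →ₗ[F] F) (y : M) (x : K ⊗[F] M) :
    (f.smulRight y).baseChange K x = TensorProduct.rid F K (f.lTensor K x) ⊗ₜ[F] y := by
  induction x with
  | zero => simp
  | add x z hx hz => simp [hx, hz, TensorProduct.add_tmul]
  | tmul c z => simp [TensorProduct.smul_tmul]

end LinearAlgebraLemmas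

/-! ### Central simple algebras under field extension -/

section CentralSimple

/-- The multiplication algebra: the unital associative algebra generated by all left and right
multiplications. -/
def mulAlgebra (F B : Type*) [CommRing F] [NonUnitalNonAssocRing B] [Module F B]
    [IsScalarTower F B B] [SMulCommClass F B B] : Subalgebra F (Module.End F B) :=
  Algebra.adjoin F (Set.range (LinearMap.mulLeft F) ∪ Set.range (LinearMap.mulRight F))

variable {F B : Type*} [Field F] [NonUnitalNonAssocRing B] [Module F B]
    [IsScalarTower F B B] [SMulCommClass F B B]

/-- Submodules over the multiplication algebra are stable under left and right multiplications, so
they are ideals. -/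
theorem IsSimpleAlg.isSimpleModule_mulAlgebra (hB : IsSimpleAlg F B) :
    IsSimpleModule (mulAlgebra F B) B := by
  obtain ⟨x, y, hxy⟩ := hB.1
  have : Nontrivial B := ⟨⟨x * y, 0, hxy⟩⟩
  rw [isSimpleModule_iff]
  refine { eq_bot_or_eq_top := fun p => ?_ }
  have hp : IsAlgIdeal F B (p.restrictScalars F) := by
    intro x hx a
    constructor
    · exact p.smul_mem ⟨LinearMap.mulLeft F a, Algebra.subset_adjoin (Or.inl ⟨a, rfl⟩)⟩ hx
    · exact p.smul_mem ⟨LinearMap.mulRight F a, Algebra.subset_adjoin (Or.inr ⟨a, rfl⟩)⟩ hx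
  simpa using hB.2 _ hp

/-- The commutant of the multiplication algebra consists of centroid elements, hence of scalars.
Every linear map therefore lies in the double commutant, and by density it agrees on a finite
spanning set with an element of the algebra. -/
theorem IsSimpleAlg.mulAlgebra_eq_top [Module.Finite F B] (hB : IsSimpleAlg F B)
    (hc : IsCentralAlg F B) : mulAlgebra F B = ⊤ := by
  have := hB.isSimpleModule_mulAlgebra
  rw [eq_top_iff]
  intro g _
  have hscalar : ∀ h : Module.End (mulAlgebra F B) B, ∃ c : F, ∀ x, h x = c • x := by
    intro h
    have hmem : h.restrictScalars F ∈ algCentroid F B := by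
      intro x y
      constructor
      · exact h.map_smul ⟨LinearMap.mulRight F y, Algebra.subset_adjoin (Or.inr ⟨y, rfl⟩)⟩ x
      · exact h.map_smul ⟨LinearMap.mulLeft F x, Algebra.subset_adjoin (Or.inl ⟨x, rfl⟩)⟩ y
    obtain ⟨c, hc⟩ := hc.2 ⟨_, hmem⟩
    exact ⟨c, fun x => (LinearMap.congr_fun (congrArg Subtype.val hc) x).symm⟩
  let f : Module.End (Module.End (mulAlgebra F B) B) B :=
    { g with
      map_smul' := by
        intro h x
        obtain ⟨c, hc⟩ := hscalar h
        simp [Module.End.smul_def, hc] }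
  obtain ⟨s, hs⟩ := Module.Finite.fg_top (R := F) (M := B)
  obtain ⟨r, hr⟩ := jacobson_density f s
  have : g = r.1 := LinearMap.ext_on hs fun x hx => hr x hx
  rw [this]
  exact r.2

variable {K : Type*} [Field K] [Algebra F K]

theorem baseChange_mulLeft (a : B) :
    (LinearMap.mulLeft F a).baseChange K = LinearMap.mulLeft K ((1 : K) ⊗ₜ[F] a) := by
  ext x
  simp

theorem baseChange_mulRight (a : B) :
    (LinearMap.mulRight F a).baseChange K = LinearMap.mulRight K ((1 : K) ⊗ₜ[F] a) := by
  ext x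
  simp

/-- Since `g` is built from multiplications, its base change is built from multiplications by
elements `1 ⊗ a`, and these preserve ideals. -/
theorem baseChange_mem_of_isAlgIdeal [Module.Finite F B] (hB : IsSimpleAlg F B)
    (hc : IsCentralAlg F B) {I : Submodule K (K ⊗[F] B)} (hI : IsAlgIdeal K (K ⊗[F] B) I)
    (g : Module.End F B) {x : K ⊗[F] B} (hx : x ∈ I) : g.baseChange K x ∈ I := by
  have hg : g ∈ mulAlgebra F B := hB.mulAlgebra_eq_top hc ▸ Algebra.mem_top
  unfold mulAlgebra at hg
  induction hg using Algebra.adjoin_induction generalizing x with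
  | mem g hg =>
    obtain ⟨a, rfl⟩ | ⟨a, rfl⟩ := hg
    · rw [baseChange_mulLeft]
      exact (hI x hx _).1
    · rw [baseChange_mulRight]
      exact (hI x hx _).2
  | algebraMap r =>
    rw [Algebra.algebraMap_eq_smul_one, LinearMap.baseChange_smul, LinearMap.baseChange_one]
    exact I.smul_of_tower_mem r hx
  | add g h _ _ hg hh =>
    rw [LinearMap.baseChange_add]
    exact I.add_mem (hg hx) (hh hx)
  | mul g h _ _ hg hh =>
    rw [LinearMap.baseChange_mul]
    exact hg (hh hx)

/-- Same mechanism: centroid elements commute with multiplications by `1 ⊗ a`, which generate all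
maps `g.baseChange K`. -/
theorem algCentroid_baseChange_comm [Module.Finite F B] (hB : IsSimpleAlg F B)
    (hc : IsCentralAlg F B) (χ : algCentroid K (K ⊗[F] B))
    (g : Module.End F B) (x : K ⊗[F] B) : χ.1 (g.baseChange K x) = g.baseChange K (χ.1 x) := by
  have hg : g ∈ mulAlgebra F B := hB.mulAlgebra_eq_top hc ▸ Algebra.mem_top
  unfold mulAlgebra at hg
  induction hg using Algebra.adjoin_induction generalizing x with
  | mem g hg =>
    obtain ⟨a, rfl⟩ | ⟨a, rfl⟩ := hg
    · rw [baseChange_mulLeft]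
      exact (χ.2 _ x).2
    · rw [baseChange_mulRight]
      exact (χ.2 x _).1
  | algebraMap r =>
    rw [Algebra.algebraMap_eq_smul_one, LinearMap.baseChange_smul, LinearMap.baseChange_one]
    exact χ.1.map_smul_of_tower r x
  | add g h _ _ hg hh =>
    rw [LinearMap.baseChange_add, LinearMap.add_apply, map_add, hg, hh, LinearMap.add_apply]
  | mul g h _ _ hg hh =>
    rw [LinearMap.baseChange_mul, Module.End.mul_apply, hg, hh, Module.End.mul_apply]

/-- Finite dimensional central simple algebras stay simple under field extension. -/
theorem IsSimpleAlg.baseChange [Module.Finite F B] (hB : IsSimpleAlg F B)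
    (hc : IsCentralAlg F B) : IsSimpleAlg K (K ⊗[F] B) := by
  constructor
  · obtain ⟨x, y, hxy⟩ := hB.1
    refine ⟨1 ⊗ₜ x, 1 ⊗ₜ y, ?_⟩
    rw [Algebra.TensorProduct.tmul_mul_tmul, one_mul]
    intro h
    apply hxy
    apply Module.FaithfullyFlat.tensorProduct_mk_injective (A := F) (B := K) B
    simpa using h
  · intro I hI
    by_cases hbot : I = ⊥
    · exact Or.inl hbot
    right
    obtain ⟨x, hx, hx0⟩ := I.ne_bot_iff.1 hbot
    obtain ⟨f, hf⟩ := exists_rid_lTensor_ne_zero hx0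
    rw [eq_top_iff]
    rintro z -
    induction z with
    | zero => exact I.zero_mem
    | add y z hy hz => exact I.add_mem hy hz
    | tmul c y =>
      -- The rank-one map `f.smulRight y` sends `x` to a nonzero scalar tensor `y`; dividing by that
      -- scalar puts `c ⊗ y` into `I`.
      have h := I.smul_mem (c * (TensorProduct.rid F K (f.lTensor K x))⁻¹)
        (baseChange_mem_of_isAlgIdeal hB hc hI (f.smulRight y) hx)
      rwa [baseChange_smulRight, TensorProduct.smul_tmul', smul_eq_mul, mul_assoc,
        inv_mul_cancel₀ hf, mul_one] at h

/-- Finite dimensional central simple algebras stay central under field extension. -/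
theorem IsCentralAlg.baseChange [Module.Finite F B] (hB : IsSimpleAlg F B)
    (hc : IsCentralAlg F B) : IsCentralAlg K (K ⊗[F] B) := by
  obtain ⟨x, y, hxy⟩ := (hB.baseChange hc (K := K)).1
  have : Nontrivial (K ⊗[F] B) := ⟨⟨x * y, 0, hxy⟩⟩
  constructor
  · intro c d h
    have := LinearMap.congr_fun (congrArg Subtype.val h) (x * y)
    exact smul_left_injective K hxy this
  · intro χ
    obtain ⟨b, c, hbc⟩ := hB.1
    obtain ⟨f, hf⟩ := Module.Projective.exists_dual_ne_zero F hbc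
    let z := b * c
    -- The normalised `f` is 1 at `z`, so the rank-one map with value `y` takes `1 ⊗ z` to `1 ⊗ y`.
    -- As `χ` commutes with it, `χ (1 ⊗ y) = κ ⊗ y` for one `κ` independent of `y`.
    let κ := TensorProduct.rid F K ((((f z)⁻¹ • f).lTensor K) (χ.1 (1 ⊗ₜ z)))
    refine ⟨κ, Subtype.ext (LinearMap.ext fun t => ?_)⟩
    change κ • t = χ.1 t
    induction t with
    | zero => simp
    | add y z hy hz => rw [smul_add, hy, hz, map_add]
    | tmul d y =>
      have h := algCentroid_baseChange_comm hB hc χ (((f z)⁻¹ • f).smulRight y) (1 ⊗ₜ z)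
      rw [baseChange_smulRight, baseChange_smulRight] at h
      have h1 : (d ⊗ₜ[F] y : K ⊗[F] B) = d • (1 ⊗ₜ y) := by
        rw [TensorProduct.smul_tmul', smul_eq_mul, mul_one]
      have h2 : TensorProduct.rid F K ((((f z)⁻¹ • f).lTensor K) ((1 : K) ⊗ₜ z)) = 1 := by
        simp [z, hf]
      rw [h2] at h
      rw [h1, map_smul, h, TensorProduct.smul_tmul', TensorProduct.smul_tmul',
        TensorProduct.smul_tmul', smul_eq_mul, smul_eq_mul, smul_eq_mul, mul_one, mul_comm]

end CentralSimple

/-! ### Algebra isomorphisms and transport of properties -/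

section AlgIsoEquivalence

variable {K A B : Type*} [Semiring K] [NonUnitalNonAssocSemiring A] [Module K A]
  [NonUnitalNonAssocSemiring B] [Module K B]

theorem AlgIso.symm (h : AlgIso K A B) : AlgIso K B A := by
  obtain ⟨e, he⟩ := h
  refine ⟨e.symm, fun x y => e.injective ?_⟩
  rw [he]
  simp

theorem AlgIso.trans {C : Type*} [NonUnitalNonAssocSemiring C] [Module K C]
    (h : AlgIso K A B)
    (h' : AlgIso K B C) : AlgIso K A C := by
  obtain ⟨e, he⟩ := h
  obtain ⟨f, hf⟩ := h'
  exact ⟨e.trans f, fun x y => by simp [he, hf]⟩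

end AlgIsoEquivalence

section AlgIsoTransport

variable {K A B : Type*} [Field K] [NonUnitalNonAssocRing A] [Module K A]
  [NonUnitalNonAssocRing B] [Module K B]

theorem IsSimpleAlg.of_algIso (h : AlgIso K A B) (hA : IsSimpleAlg K A) : IsSimpleAlg K B := by
  obtain ⟨e, he⟩ := h
  obtain ⟨⟨x, y, hxy⟩, hA⟩ := hA
  refine ⟨⟨e x, e y, ?_⟩, fun I hI => ?_⟩
  · rw [← he]
    simpa using hxy
  · have h := hA (I.comap e.toLinearMap) fun x hx a => by
      simp only [Submodule.mem_comap, LinearEquiv.coe_coe, he] at hx ⊢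
      exact hI _ hx _
    rcases h with h | h
    · left
      rw [← Submodule.map_comap_eq_of_surjective e.surjective I]
      exact h ▸ Submodule.map_bot _
    · right
      rw [eq_top_iff]
      intro y _
      have : e.symm y ∈ I.comap e.toLinearMap := h ▸ Submodule.mem_top
      simpa using this

theorem IsCentralAlg.of_algIso [IsScalarTower K A A] [SMulCommClass K A A]
    [IsScalarTower K B B] [SMulCommClass K B B]
    (h : AlgIso K A B) (hA : IsCentralAlg K A) : IsCentralAlg K B := by
  obtain ⟨e, he⟩ := h
  constructor
  · intro c d h
    apply hA.1
    ext x
    apply e.injective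
    have := LinearMap.congr_fun (congrArg Subtype.val h) (e x)
    change e (c • x) = e (d • x)
    rw [map_smul, map_smul]
    exact this
  · intro χ
    have hm : e.symm.conj χ.1 ∈ algCentroid K A := by
      intro x y
      simp only [LinearEquiv.conj_apply, LinearMap.comp_apply, LinearEquiv.coe_coe,
        LinearEquiv.symm_symm]
      constructor
      · apply e.injective
        rw [he, he, (χ.2 _ _).1]
        simp
      · apply e.injective
        rw [he, he, (χ.2 _ _).2]
        simp
    obtain ⟨c, hc⟩ := hA.2 ⟨_, hm⟩
    refine ⟨c, ?_⟩
    ext y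
    have := congrArg e (LinearMap.congr_fun (congrArg Subtype.val hc) (e.symm y))
    change e (c • e.symm y) = _ at this
    change c • y = χ.1 y
    simpa [LinearEquiv.conj_apply] using this

end AlgIsoTransport

/-! ### The centroid of a prime algebra -/

section Centroid

variable {k A : Type*} [Field k] [NonUnitalNonAssocRing A] [Module k A] [IsScalarTower k A A]
  [SMulCommClass k A A]

theorem isAlgIdeal_ker_centroid (χ : algCentroid k A) : IsAlgIdeal k A (LinearMap.ker χ.1) := by
  intro x hx a
  rw [LinearMap.mem_ker] at hx
  simp only [LinearMap.mem_ker]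
  rw [(χ.2 a x).2, (χ.2 x a).1, hx, mul_zero, zero_mul]
  exact ⟨rfl, rfl⟩

theorem isAlgIdeal_range_centroid (χ : algCentroid k A) :
    IsAlgIdeal k A (LinearMap.range χ.1) := by
  rintro _ ⟨x, rfl⟩ a
  exact ⟨⟨a * x, (χ.2 a x).2⟩, ⟨x * a, (χ.2 x a).1⟩⟩

/-- The kernel and the range of `χ` are ideals with product zero: `x * χ y = χ (x * y) = χ x * y`.
-/
theorem IsPrimeAlg.centroid_smul_eq_zero (hA : IsPrimeAlg k A) {χ : algCentroid k A} {x : A}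
    (h : χ • x = 0) : χ = 0 ∨ x = 0 := by
  rcases hA _ _ (isAlgIdeal_ker_centroid χ) (isAlgIdeal_range_centroid χ) (by
    rintro x hx _ ⟨y, rfl⟩
    rw [← (χ.2 x y).2, (χ.2 x y).1, LinearMap.mem_ker.1 hx, zero_mul]) with h1 | h1
  · right
    have : x ∈ LinearMap.ker χ.1 := h
    rwa [h1, Submodule.mem_bot] at this
  · left
    exact Subtype.ext (LinearMap.range_eq_bot.1 h1)

theorem IsPrimeAlg.isDomain_algCentroid [IsPfgc k A] (hA : IsPrimeAlg k A) :
    IsDomain (algCentroid k A) := by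
  have := IsPfgc.nontrivial (K := k) (A := A)
  obtain ⟨x, hx⟩ := exists_ne (0 : A)
  have : Nontrivial (algCentroid k A) := by
    refine ⟨1, 0, fun h => hx ?_⟩
    exact LinearMap.congr_fun (congrArg Subtype.val h) x
  have : NoZeroDivisors (algCentroid k A) := by
    refine ⟨fun {χ ψ} h => ?_⟩
    by_cases hψ : ψ.1 x = 0
    · exact Or.inr ((hA.centroid_smul_eq_zero hψ).resolve_right hx)
    · exact Or.inl ((hA.centroid_smul_eq_zero (χ := χ) (x := ψ.1 x)
        (LinearMap.congr_fun (congrArg Subtype.val h) x)).resolve_right hψ)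
  exact NoZeroDivisors.to_isDomain _

end Centroid

/-! ### Central closure over the fraction field -/

section FractionTensor

variable {Z A F : Type*} [CommRing Z] [IsDomain Z] [AddCommGroup A] [Module Z A] [Field F]
  [Algebra Z F] [IsFractionRing Z F]

theorem fractionTensor_exists_smul_eq (t : F ⊗[Z] A) :
    ∃ s : Z, s ≠ 0 ∧ ∃ a : A, algebraMap Z F s • t = (1 : F) ⊗ₜ[Z] a := by
  obtain ⟨⟨a, s⟩, h⟩ := IsLocalizedModule.surj Z⁰ (TensorProduct.mk Z F A 1) t
  exact ⟨s, nonZeroDivisors.ne_zero s.2, a, by rw [algebraMap_smul]; exact h⟩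

theorem fractionTensor_mk_injective [Module.IsTorsionFree Z A] :
    Function.Injective fun a : A => (1 : F) ⊗ₜ[Z] a := by
  have h : Function.Injective (TensorProduct.mk Z F A 1) := by
    rw [injective_iff_map_eq_zero]
    intro a ha
    obtain ⟨s, hs⟩ := (IsLocalizedModule.eq_zero_iff Z⁰ (TensorProduct.mk Z F A 1)).1 ha
    exact (smul_eq_zero.1 hs).resolve_left (nonZeroDivisors.ne_zero s.2)
  exact h

end FractionTensor

section CentralClosure

variable {k : Type*} [Field k] {Z : Type*} [CommRing Z] [Algebra k Z]
  {A : Type*} [NonUnitalNonAssocRing A] [Module k A] [Module Z A] [IsScalarTower Z A A]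
  [SMulCommClass Z A A] [IsScalarTower k Z A]
  {F : Type*} [Field F] [Algebra Z F] [IsDomain Z] [IsFractionRing Z F]

/-- Contract ideals to `A`. Clearing denominators shows that a nonzero ideal contracts to a nonzero
ideal. -/
theorem IsPrimeAlg.fractionTensor [Algebra k F] [IsScalarTower k Z F]
    [Module.IsTorsionFree Z A] (hA : IsPrimeAlg k A) :
    IsPrimeAlg F (F ⊗[Z] A) := by
  let ι : A →ₗ[k] F ⊗[Z] A := (TensorProduct.mk Z F A 1).restrictScalars k
  have hι : Function.Injective ι := fractionTensor_mk_injective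
  have hmul : ∀ x y, ι (x * y) = ι x * ι y := fun x y => by
    simp [ι]
  have hideal : ∀ I : Submodule F (F ⊗[Z] A), IsAlgIdeal F _ I →
      IsAlgIdeal k A ((I.restrictScalars k).comap ι) := by
    intro I hI x hx a
    simp only [Submodule.mem_comap, Submodule.restrictScalars_mem, hmul] at hx ⊢
    exact hI _ hx _
  have hbot : ∀ I : Submodule F (F ⊗[Z] A), (I.restrictScalars k).comap ι = ⊥ → I = ⊥ := by
    intro I h
    rw [eq_bot_iff]
    intro t ht
    obtain ⟨s, hs, a, hst⟩ := fractionTensor_exists_smul_eq t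
    have ha : a ∈ (I.restrictScalars k).comap ι := by
      change (1 : F) ⊗ₜ[Z] a ∈ I
      rw [← hst]
      exact I.smul_mem _ ht
    rw [h, Submodule.mem_bot] at ha
    rw [ha, TensorProduct.tmul_zero] at hst
    exact (smul_eq_zero.1 hst).resolve_left
      ((map_ne_zero_iff _ (IsFractionRing.injective Z F)).2 hs)
  intro I J hI hJ hIJ
  rcases hA _ _ (hideal I hI) (hideal J hJ) (fun x hx y hy => hι (by
    rw [hmul, map_zero]; exact hIJ _ hx _ hy)) with h | h
  · exact Or.inl (hbot I h)
  · exact Or.inr (hbot J h)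

variable [IsScalarTower k A A] [SMulCommClass k A A]

/-- Finite generation yields a common denominator `s` for which `s • χ` preserves the copy of `A`.
The restriction is a centroid element of `A`, hence acts as some `c` in `Z`, and `χ` is
multiplication by `c / s`. -/
theorem IsCentralAlg.fractionTensor [Module.IsTorsionFree Z A] [Module.Finite Z A] [Nontrivial A]
    (hZ : ∀ χ ∈ algCentroid k A, ∃ c : Z, ∀ x, χ x = c • x) :
    IsCentralAlg F (F ⊗[Z] A) := by
  have hι : Function.Injective fun a : A => (1 : F) ⊗ₜ[Z] a := fractionTensor_mk_injective
  constructor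
  · intro c d h
    obtain ⟨x, hx⟩ := exists_ne (0 : A)
    have h1 : c • ((1 : F) ⊗ₜ[Z] x) = d • ((1 : F) ⊗ₜ[Z] x) :=
      LinearMap.congr_fun (congrArg Subtype.val h) ((1 : F) ⊗ₜ[Z] x)
    have hx' : (1 : F) ⊗ₜ[Z] x ≠ 0 := by
      rw [← TensorProduct.tmul_zero A (1 : F)]
      exact fun h => hx (hι h)
    exact smul_left_injective F hx' h1
  · intro χ
    obtain ⟨S, hS⟩ := Module.Finite.fg_top (R := Z) (M := A)
    have hden : ∃ s : Z, s ≠ 0 ∧ ∀ x ∈ S, ∃ a : A,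
        algebraMap Z F s • χ.1 (1 ⊗ₜ x) = (1 : F) ⊗ₜ[Z] a := by
      classical
      clear hS
      induction S using Finset.induction_on with
      | empty => exact ⟨1, one_ne_zero, by simp⟩
      | insert x S _ ih =>
        obtain ⟨s, hs, h⟩ := ih
        obtain ⟨t, ht, a, hta⟩ := fractionTensor_exists_smul_eq (χ.1 ((1 : F) ⊗ₜ[Z] x))
        refine ⟨s * t, mul_ne_zero hs ht, fun y hy => ?_⟩
        rcases Finset.mem_insert.1 hy with rfl | hy
        · refine ⟨s • a, ?_⟩
          rw [map_mul, mul_smul, hta, algebraMap_smul, TensorProduct.tmul_smul]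
        · obtain ⟨b, hb⟩ := h y hy
          refine ⟨t • b, ?_⟩
          rw [map_mul, mul_comm, mul_smul, hb, algebraMap_smul, TensorProduct.tmul_smul]
    obtain ⟨s, hs, h⟩ := hden
    have hall : ∀ x : A, ∃ a : A, algebraMap Z F s • χ.1 (1 ⊗ₜ x) = (1 : F) ⊗ₜ[Z] a := by
      intro x
      have hx : x ∈ Submodule.span Z (S : Set A) := hS ▸ Submodule.mem_top
      induction hx using Submodule.span_induction with
      | mem x hx => exact h x hx
      | zero => exact ⟨0, by simp⟩
      | add x y _ _ hx hy =>
        obtain ⟨a, ha⟩ := hx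
        obtain ⟨b, hb⟩ := hy
        exact ⟨a + b, by rw [TensorProduct.tmul_add, map_add, smul_add, ha, hb,
          TensorProduct.tmul_add]⟩
      | smul c x _ hx =>
        obtain ⟨a, ha⟩ := hx
        refine ⟨c • a, ?_⟩
        rw [TensorProduct.tmul_smul, TensorProduct.tmul_smul, ← ha, ← algebraMap_smul F c,
          map_smul, smul_comm, algebraMap_smul]
    choose ψ hψ using hall
    let Ψ : Module.End k A :=
      { toFun := ψ
        map_add' := fun x y => hι (by
          change (1 : F) ⊗ₜ[Z] ψ (x + y) = 1 ⊗ₜ (ψ x + ψ y)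
          rw [← hψ, TensorProduct.tmul_add, map_add, smul_add, hψ, hψ, TensorProduct.tmul_add])
        map_smul' := fun c x => hι (by
          change (1 : F) ⊗ₜ[Z] ψ (c • x) = 1 ⊗ₜ (c • ψ x)
          rw [← hψ, ← algebraMap_smul Z c x, TensorProduct.tmul_smul,
            ← algebraMap_smul F (algebraMap k Z c), map_smul, smul_comm, hψ, algebraMap_smul,
            ← TensorProduct.tmul_smul, algebraMap_smul]) }
    have hmul : ∀ x y : A, (1 : F) ⊗ₜ[Z] (x * y) = (1 ⊗ₜ x) * (1 ⊗ₜ y) := fun x y => by simp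
    have hΨ : Ψ ∈ algCentroid k A := by
      intro x y
      constructor
      · apply hι
        change (1 : F) ⊗ₜ[Z] ψ (x * y) = 1 ⊗ₜ (ψ x * y)
        rw [hmul, ← hψ, ← hψ, hmul, (χ.2 _ _).1, smul_mul_assoc]
      · apply hι
        change (1 : F) ⊗ₜ[Z] ψ (x * y) = 1 ⊗ₜ (x * ψ y)
        rw [hmul, ← hψ, ← hψ, hmul, (χ.2 _ _).2, mul_smul_comm]
    obtain ⟨c, hc⟩ := hZ Ψ hΨ
    have hs' : algebraMap Z F s ≠ 0 := (map_ne_zero_iff _ (IsFractionRing.injective Z F)).2 hs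
    refine ⟨algebraMap Z F c / algebraMap Z F s, Subtype.ext ?_⟩
    change algebraMap F (Module.End F (F ⊗[Z] A)) _ = χ.1
    ext x
    simp only [TensorProduct.AlgebraTensorModule.curry_apply, TensorProduct.curry_apply,
      LinearMap.coe_restrictScalars, Module.algebraMap_end_apply]
    rw [div_eq_inv_mul, mul_smul, inv_smul_eq_iff₀ hs', hψ, algebraMap_smul,
      ← TensorProduct.tmul_smul]
    exact congrArg _ (hc x).symm

end CentralClosure

/-! ### Prime sums of simple algebras -/

section DirectSum

/-- A nonzero prime algebra that is a direct sum of simple algebras is simple. -/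
theorem IsPrimeAlg.isSimpleAlg {K : Type u} [Field K] {A : Type u} [NonUnitalNonAssocRing A]
    [Module K A] [Nontrivial A] (hA : IsPrimeAlg K A) (hS : IsDirectSumOfSimple K A) :
    IsSimpleAlg K A := by
  classical
  obtain ⟨r, S, hSi, e, he⟩ := hS
  obtain ⟨x, hx⟩ := exists_ne (0 : A)
  obtain ⟨i, hi⟩ : ∃ i, e x i ≠ 0 := by
    by_contra! h
    exact hx (e.injective (by rw [map_zero]; exact funext h))
  -- `I` collects the elements with zero `i`-th coordinate, `J` those with only that coordinate.
  -- Their product vanishes and `J` is nonzero, so `I = 0` and projection to the `i`-th summand is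
  -- an isomorphism.
  let I : Submodule K A := LinearMap.ker ((LinearMap.proj i).comp e.toLinearMap)
  let J : Submodule K A :=
    { carrier := {y | ∀ j, j ≠ i → e y j = 0}
      zero_mem' := fun j _ => by simp
      add_mem' := fun {a b} ha hb j hj => by
        rw [map_add, Pi.add_apply, ha j hj, hb j hj, add_zero]
      smul_mem' := fun c a ha j hj => by
        rw [map_smul, Pi.smul_apply, ha j hj, smul_zero] }
  have hI : IsAlgIdeal K A I := by
    intro y hy a
    have hy : e y i = 0 := hy
    constructor
    · change e (a * y) i = 0
      rw [he, Pi.mul_apply, hy, mul_zero]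
    · change e (y * a) i = 0
      rw [he, Pi.mul_apply, hy, zero_mul]
  have hJ : IsAlgIdeal K A J := by
    intro y hy a
    constructor
    · intro j hj
      rw [he, Pi.mul_apply, hy j hj, mul_zero]
    · intro j hj
      rw [he, Pi.mul_apply, hy j hj, zero_mul]
  have hIJ := hA I J hI hJ fun a ha b hb => e.injective (by
    rw [he, map_zero]
    funext j
    by_cases hj : j = i
    · subst hj
      have ha : e a j = 0 := ha
      rw [Pi.mul_apply, ha, zero_mul, Pi.zero_apply]
    · rw [Pi.mul_apply, hb j hj, mul_zero, Pi.zero_apply])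
  have hsurj : Function.Surjective ((LinearMap.proj i).comp e.toLinearMap : A →ₗ[K] S i) :=
    fun y => ⟨e.symm (Pi.single i y), by simp⟩
  rcases hIJ with h | h
  · let f := LinearEquiv.ofBijective _ ⟨LinearMap.ker_eq_bot.1 h, hsurj⟩
    have hf : AlgIso K A (S i) := ⟨f, fun a b => by
      change e (a * b) i = e a i * e b i
      rw [he, Pi.mul_apply]⟩
    exact (hSi i).of_algIso hf.symm
  · exfalso
    have hmem : e.symm (Pi.single i (e x i)) ∈ J := fun j hj => by simp [hj]
    rw [h, Submodule.mem_bot, LinearEquiv.map_eq_zero_iff, Pi.single_eq_zero_iff] at hmem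
    exact hi hmem

end DirectSum

/-! ### Base change of algebra isomorphisms -/

section BaseChangeIso

/-- Multiplicativity of an additive map on a tensor product can be tested on pure tensors. -/
theorem map_mul_of_map_tmul_mul {R E B C : Type*} [CommRing R] [NonUnitalNonAssocRing E]
    [Module R E] [IsScalarTower R E E] [SMulCommClass R E E] [NonUnitalNonAssocRing B] [Module R B]
    [IsScalarTower R B B] [SMulCommClass R B B] [NonUnitalNonAssocRing C]
    (f : E ⊗[R] B →+ C)
    (h : ∀ a b c d, f ((a * c) ⊗ₜ (b * d)) = f (a ⊗ₜ b) * f (c ⊗ₜ d)) (x y : E ⊗[R] B) :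
    f (x * y) = f x * f y := by
  induction x with
  | zero => simp
  | add x x' hx hx' => rw [add_mul, map_add, map_add, hx, hx', add_mul]
  | tmul a b =>
    induction y with
    | zero => simp
    | add y y' hy hy' => rw [mul_add, map_add, map_add, hy, hy', mul_add]
    | tmul c d => rw [Algebra.TensorProduct.tmul_mul_tmul, h]

theorem algIso_cancelBaseChange (Z S K A : Type*) [CommRing Z] [CommRing S] [Field K]
    [Algebra Z S] [Algebra S K] [Algebra Z K] [IsScalarTower Z S K]
    [NonUnitalNonAssocRing A] [Module Z A] [IsScalarTower Z A A] [SMulCommClass Z A A] :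
    AlgIso K (K ⊗[S] (S ⊗[Z] A)) (K ⊗[Z] A) := by
  refine ⟨TensorProduct.AlgebraTensorModule.cancelBaseChange Z S K K A, ?_⟩
  refine map_mul_of_map_tmul_mul
    (TensorProduct.AlgebraTensorModule.cancelBaseChange Z S K K A).toLinearMap.toAddMonoidHom ?_
  intro a b c d
  change TensorProduct.AlgebraTensorModule.cancelBaseChange Z S K K A ((a * c) ⊗ₜ (b * d)) =
    TensorProduct.AlgebraTensorModule.cancelBaseChange Z S K K A (a ⊗ₜ b) *
      TensorProduct.AlgebraTensorModule.cancelBaseChange Z S K K A (c ⊗ₜ d)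
  induction b with
  | zero => simp
  | add x x' hx hx' =>
    rw [add_mul, TensorProduct.tmul_add, TensorProduct.tmul_add, map_add, map_add, hx, hx', add_mul]
  | tmul s x =>
    induction d with
    | zero => simp
    | add y y' hy hy' =>
      rw [mul_add, TensorProduct.tmul_add, TensorProduct.tmul_add, map_add, map_add, hy, hy',
        mul_add]
    | tmul t y => simp [mul_comm s t, mul_smul]

theorem AlgIso.baseChange {K B C : Type*} (E : Type*) [Field K] [Field E] [Algebra K E]
    [NonUnitalNonAssocRing B] [Module K B] [IsScalarTower K B B] [SMulCommClass K B B]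
    [NonUnitalNonAssocRing C] [Module K C] [IsScalarTower K C C] [SMulCommClass K C C]
    (h : AlgIso K B C) : AlgIso E (E ⊗[K] B) (E ⊗[K] C) := by
  obtain ⟨e, he⟩ := h
  refine ⟨e.baseChange K E B C, ?_⟩
  exact map_mul_of_map_tmul_mul (e.baseChange K E B C).toLinearMap.toAddMonoidHom fun a b c d => by
    simp [he]

end BaseChangeIso

/-! ### Central simplicity of base changes of prime algebras -/

section CentralBaseChange

theorem span_range_mk_eq_top (R M S : Type*) [CommRing R] [CommRing S] [Algebra R S]
    [AddCommGroup M] [Module R M] :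
    Submodule.span S (Set.range (TensorProduct.mk R S M 1)) = ⊤ := by
  rw [eq_top_iff]
  rintro t -
  induction t with
  | zero => exact Submodule.zero_mem _
  | add x y hx hy => exact Submodule.add_mem _ hx hy
  | tmul c y =>
    have : (c ⊗ₜ[R] y : S ⊗[R] M) = c • (1 ⊗ₜ y) := by
      rw [TensorProduct.smul_tmul', smul_eq_mul, mul_one]
    rw [this]
    exact Submodule.smul_mem _ _ (Submodule.subset_span ⟨y, rfl⟩)

variable {k : Type u} [Field k] {V : Set (FreeNonUnitalNonAssocAlgebra k ℕ)}
  {Z : Type u} [CommRing Z] [Algebra k Z]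
  {A : Type u} [NonUnitalNonAssocRing A] [Module k A] [IsScalarTower k A A]
  [SMulCommClass k A A] [Module Z A] [IsScalarTower Z A A]
  [SMulCommClass Z A A] [IsScalarTower k Z A]

theorem IsVAlg.tensorProduct (K : Type*) [Field K] [Algebra k K] [Algebra Z K]
    [IsScalarTower k Z K] (hV : IsHomogeneousVariety V) (hVA : IsVAlg V A) :
    IsVAlg V (K ⊗[Z] A) := by
  let φ : A →ₙₐ[k] K ⊗[Z] A :=
    { (TensorProduct.mk Z K A 1).restrictScalars k with
      map_zero' := map_zero _
      map_mul' := fun x y => by simp }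
  exact IsVAlg.of_span_eq_top hV (K := K) φ hVA (span_range_mk_eq_top _ _ _)

/-- This is where axiom (S) enters: it applies over the fraction field `F`, where primeness then
gives simplicity. The passage from `F` to `K` is base change of central simple algebras. -/
theorem IsPrimeAlg.isSimpleAlg_and_isCentralAlg_tensorProduct (F : Type u) [Field F]
    [Algebra k F] [Algebra Z F] [IsScalarTower k Z F] [IsDomain Z] [IsFractionRing Z F]
    (K : Type*) [Field K] [Algebra F K] [Algebra Z K] [IsScalarTower Z F K]
    [Module.IsTorsionFree Z A] [Module.Finite Z A] [Nontrivial A]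
    (hZ : ∀ χ ∈ algCentroid k A, ∃ c : Z, ∀ x, χ x = c • x)
    (hV : IsHomogeneousVariety V) (hS : AxiomS V) (hA : IsPrimeAlg k A) (hVA : IsVAlg V A) :
    IsSimpleAlg K (K ⊗[Z] A) ∧ IsCentralAlg K (K ⊗[Z] A) := by
  have hprime : IsPrimeAlg F (F ⊗[Z] A) := hA.fractionTensor
  have hcentral : IsCentralAlg F (F ⊗[Z] A) := IsCentralAlg.fractionTensor hZ
  have : Nontrivial (F ⊗[Z] A) :=
    (fractionTensor_mk_injective (Z := Z) (A := A) (F := F)).nontrivial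
  have hsimple : IsSimpleAlg F (F ⊗[Z] A) :=
    hprime.isSimpleAlg (hS F _ (hVA.tensorProduct F hV) inferInstance
      fun I hI h => (or_self_iff.1 (hprime I I hI hI h)))
  have hiso := algIso_cancelBaseChange Z F K A
  exact ⟨(hsimple.baseChange hcentral).of_algIso hiso,
    (hcentral.baseChange hsimple).of_algIso hiso⟩

end CentralBaseChange

section CentroidBaseChange

variable {k : Type u} [Field k] {V : Set (FreeNonUnitalNonAssocAlgebra k ℕ)}
  {A : Type u} [NonUnitalNonAssocRing A] [Module k A] [IsScalarTower k A A]
  [SMulCommClass k A A] [IsPfgc k A]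

theorem IsPrimeAlg.isTorsionFree (hA : IsPrimeAlg k A) :
    Module.IsTorsionFree (algCentroid k A) A := by
  have := hA.isDomain_algCentroid
  rw [Module.isTorsionFree_iff_smul_eq_zero]
  exact fun χ x h => hA.centroid_smul_eq_zero h

theorem IsPrimeAlg.isSimpleAlg_and_isCentralAlg_centroid (K : Type u) [Field K]
    [Algebra (algCentroid k A) K] (hV : IsHomogeneousVariety V)
    (hS : AxiomS V) (hA : IsPrimeAlg k A) (hVA : IsVAlg V A)
    (hinj : Function.Injective (algebraMap (algCentroid k A) K)) :
    IsSimpleAlg K (K ⊗[algCentroid k A] A) ∧ IsCentralAlg K (K ⊗[algCentroid k A] A) := by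
  have := hA.isDomain_algCentroid
  have := hA.isTorsionFree
  have : Nontrivial A := IsPfgc.nontrivial (K := k)
  have : Module.Finite (algCentroid k A) A := IsPfgc.finite
  have : FaithfulSMul (algCentroid k A) K := (faithfulSMul_iff_algebraMap_injective _ _).2 hinj
  let _ := FractionRing.liftAlgebra (algCentroid k A) K
  have := FractionRing.isScalarTower_liftAlgebra (algCentroid k A) K
  exact hA.isSimpleAlg_and_isCentralAlg_tensorProduct (FractionRing (algCentroid k A)) K
    (fun χ hχ => ⟨⟨χ, hχ⟩, fun x => rfl⟩) hV hS hVA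

end CentroidBaseChange

/-! ### Algebras embedded as spanning subalgebras -/

section SpanningEmbedding

variable {k : Type*} [Field k] {L : Type*} [NonUnitalNonAssocRing L] [Module k L]
  {K : Type*} [Field K]
  {B : Type*} [NonUnitalNonAssocRing B] [Module K B] [IsScalarTower K B B] [SMulCommClass K B B]
  [Module k B]
  {φ : L →ₙₐ[k] B}

theorem isAlgIdeal_span_image (hspan : Submodule.span K (Set.range φ) = ⊤) {I : Submodule k L}
    (hI : IsAlgIdeal k L I) : IsAlgIdeal K B (Submodule.span K (φ '' I)) := by
  intro x hx a
  have ha : a ∈ Submodule.span K (Set.range φ) := hspan ▸ Submodule.mem_top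
  induction hx using Submodule.span_induction with
  | zero => simp
  | add x y _ _ hx hy =>
    rw [mul_add, add_mul]
    exact ⟨Submodule.add_mem _ hx.1 hy.1, Submodule.add_mem _ hx.2 hy.2⟩
  | smul c x _ hx =>
    rw [mul_smul_comm, smul_mul_assoc]
    exact ⟨Submodule.smul_mem _ _ hx.1, Submodule.smul_mem _ _ hx.2⟩
  | mem x hx =>
    obtain ⟨x, hx, rfl⟩ := hx
    induction ha using Submodule.span_induction with
    | zero => simp
    | add a b _ _ ha hb =>
      rw [mul_add, add_mul]
      exact ⟨Submodule.add_mem _ ha.1 hb.1, Submodule.add_mem _ ha.2 hb.2⟩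
    | smul c a _ ha =>
      rw [mul_smul_comm, smul_mul_assoc]
      exact ⟨Submodule.smul_mem _ _ ha.1, Submodule.smul_mem _ _ ha.2⟩
    | mem a ha =>
      obtain ⟨a, rfl⟩ := ha
      rw [← map_mul, ← map_mul]
      exact ⟨Submodule.subset_span ⟨_, (hI x hx a).1, rfl⟩,
        Submodule.subset_span ⟨_, (hI x hx a).2, rfl⟩⟩

theorem mul_eq_zero_of_mem_span {s t : Set B} (h : ∀ x ∈ s, ∀ y ∈ t, x * y = 0) {x y : B}
    (hx : x ∈ Submodule.span K s) (hy : y ∈ Submodule.span K t) : x * y = 0 := by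
  induction hx using Submodule.span_induction with
  | zero => rw [zero_mul]
  | add x x' _ _ hx hx' => rw [add_mul, hx, hx', add_zero]
  | smul c x _ hx => rw [smul_mul_assoc, hx, smul_zero]
  | mem x hx =>
    induction hy using Submodule.span_induction with
    | zero => rw [mul_zero]
    | add y y' _ _ hy hy' => rw [mul_add, hy, hy', add_zero]
    | smul c y _ hy => rw [mul_smul_comm, hy, smul_zero]
    | mem y hy => exact h x hx y hy

/-- Ideals of `L` span ideals of `B`. If two nonzero ideals had product zero, both would span `B`
and the product of `B` would be zero. -/
theorem IsSimpleAlg.isPrimeAlg_of_span_eq_top (hB : IsSimpleAlg K B)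
    (hφ : Function.Injective φ) (hspan : Submodule.span K (Set.range φ) = ⊤) :
    IsPrimeAlg k L := by
  intro I J hI hJ hIJ
  have hbot : ∀ I : Submodule k L, Submodule.span K (φ '' I) = ⊥ → I = ⊥ := by
    intro I h
    rw [eq_bot_iff]
    intro x hx
    have : φ x ∈ Submodule.span K (φ '' I) := Submodule.subset_span ⟨x, hx, rfl⟩
    rw [h, Submodule.mem_bot] at this
    exact hφ (by rw [this, map_zero])
  rcases hB.2 _ (isAlgIdeal_span_image hspan hI) with h | h
  · exact Or.inl (hbot I h)
  rcases hB.2 _ (isAlgIdeal_span_image hspan hJ) with h' | h'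
  · exact Or.inr (hbot J h')
  exfalso
  obtain ⟨x, y, hxy⟩ := hB.1
  apply hxy
  refine mul_eq_zero_of_mem_span (K := K) (s := φ '' I) (t := φ '' J) ?_ (h ▸ Submodule.mem_top)
    (h' ▸ Submodule.mem_top)
  rintro _ ⟨x, hx, rfl⟩ _ ⟨y, hy, rfl⟩
  rw [← map_mul, hIJ x hx y hy, map_zero]

/-- The two-sided annihilator is an ideal, and it is proper because the product is nonzero. -/
theorem IsSimpleAlg.eq_zero_of_annihilates (hB : IsSimpleAlg K B) {u : B}
    (hl : ∀ b, u * b = 0) (hr : ∀ b, b * u = 0) : u = 0 := by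
  let N : Submodule K B :=
    { carrier := {u | ∀ b, u * b = 0 ∧ b * u = 0}
      zero_mem' := fun b => by simp
      add_mem' := fun {x y} hx hy b => by
        rw [add_mul, mul_add, (hx b).1, (hx b).2, (hy b).1, (hy b).2, add_zero]
        exact ⟨rfl, rfl⟩
      smul_mem' := fun c x hx b => by
        rw [smul_mul_assoc, mul_smul_comm, (hx b).1, (hx b).2, smul_zero]
        exact ⟨rfl, rfl⟩ }
  have hN : IsAlgIdeal K B N := by
    intro x hx a
    rw [(hx a).1, (hx a).2]
    exact ⟨N.zero_mem, N.zero_mem⟩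
  have hu : u ∈ N := fun b => ⟨hl b, hr b⟩
  rcases hB.2 N hN with h | h
  · rwa [h, Submodule.mem_bot] at hu
  · obtain ⟨x, y, hxy⟩ := hB.1
    have hx : x ∈ N := h ▸ Submodule.mem_top
    exact absurd (hx y).1 hxy

variable [IsScalarTower k L L] [SMulCommClass k L L]

/-- Centroid elements of `L` act as scalars on a central simple algebra spanned by `L`. -/
theorem exists_centroid_scalar (hB : IsSimpleAlg K B) (hc : IsCentralAlg K B)
    (hspan : Submodule.span K (Set.range φ) = ⊤) (χ : algCentroid k L) :
    ∃ c : K, ∀ x, φ (χ • x) = c • φ x := by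
  -- The extension of `χ` to `B` should send `∑ c φ(x)` to `∑ c φ(χ x)`. Elements of `L` may become
  -- dependent over `K`, so it is first defined as `q` on formal combinations.
  let p : (L →₀ K) →ₗ[K] B := Finsupp.linearCombination K φ
  let q : (L →₀ K) →ₗ[K] B := Finsupp.linearCombination K fun x => φ (χ • x)
  have hp : LinearMap.range p = ⊤ := by rw [Finsupp.range_linearCombination, hspan]
  have hmemspan : ∀ b : B, b ∈ Submodule.span K (Set.range φ) := fun b =>
    hspan ▸ Submodule.mem_top
  have hql : ∀ (t : L →₀ K) (y : L), q t * φ y = p t * φ (χ • y) := by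
    intro t y
    induction t using Finsupp.induction_linear with
    | zero => simp
    | add s t hs ht => rw [map_add, map_add, add_mul, add_mul, hs, ht]
    | single x c =>
      simp only [p, q, Finsupp.linearCombination_single, smul_mul_assoc, ← map_mul,
        mul_smul_comm]
  have hqr : ∀ (t : L →₀ K) (y : L), φ y * q t = φ (χ • y) * p t := by
    intro t y
    induction t using Finsupp.induction_linear with
    | zero => simp
    | add s t hs ht => rw [map_add, map_add, mul_add, mul_add, hs, ht]
    | single x c =>
      simp only [p, q, Finsupp.linearCombination_single, smul_mul_assoc, ← map_mul,
        mul_smul_comm]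
  -- Well-definedness: moving `χ` to the other factor shows that `q t` annihilates the spanning set
  -- `φ(L)` on both sides when `p t = 0`.
  have hker : ∀ t, p t = 0 → q t = 0 := by
    intro t ht
    refine hB.eq_zero_of_annihilates (fun b => ?_) (fun b => ?_)
    · refine mul_eq_zero_of_mem_span (K := K) (s := {q t}) (t := Set.range φ) ?_
        (Submodule.subset_span rfl) (hmemspan b)
      rintro _ rfl _ ⟨y, rfl⟩
      rw [hql, ht, zero_mul]
    · refine mul_eq_zero_of_mem_span (K := K) (s := Set.range φ) (t := {q t}) ?_
        (hmemspan b) (Submodule.subset_span rfl)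
      rintro _ ⟨y, rfl⟩ _ rfl
      rw [hqr, ht, mul_zero]
  obtain ⟨s, hs⟩ := p.exists_rightInverse_of_surjective hp
  have hX : ∀ t, q (s (p t)) = q t := by
    intro t
    rw [← sub_eq_zero, ← map_sub]
    apply hker
    rw [map_sub, ← LinearMap.comp_apply, hs, LinearMap.id_apply, sub_self]
  have hXφ : ∀ x, (q ∘ₗ s) (φ x) = φ (χ • x) := by
    intro x
    have h := hX (Finsupp.single x 1)
    simpa [p, q] using h
  have hmem : q ∘ₗ s ∈ algCentroid K B := by
    intro x y
    have hx := hmemspan x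
    have hy := hmemspan y
    induction hx using Submodule.span_induction with
    | zero => simp
    | add x x' _ _ hx hx' =>
      rw [add_mul, map_add, map_add, add_mul, add_mul]
      exact ⟨by rw [hx.1, hx'.1], by rw [hx.2, hx'.2]⟩
    | smul c x _ hx =>
      rw [smul_mul_assoc, map_smul, map_smul, smul_mul_assoc, smul_mul_assoc]
      exact ⟨by rw [hx.1], by rw [hx.2]⟩
    | mem x hx =>
      obtain ⟨x, rfl⟩ := hx
      induction hy using Submodule.span_induction with
      | zero => simp
      | add y y' _ _ hy hy' =>
        rw [mul_add, map_add, map_add, mul_add, mul_add]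
        exact ⟨by rw [hy.1, hy'.1], by rw [hy.2, hy'.2]⟩
      | smul c y _ hy =>
        rw [mul_smul_comm, map_smul, map_smul, mul_smul_comm, mul_smul_comm]
        exact ⟨by rw [hy.1], by rw [hy.2]⟩
      | mem y hy =>
        obtain ⟨y, rfl⟩ := hy
        rw [← map_mul, hXφ, hXφ, hXφ, ← map_mul, ← map_mul, smul_mul_assoc, mul_smul_comm]
        exact ⟨rfl, rfl⟩
  obtain ⟨c, hc⟩ := hc.2 ⟨_, hmem⟩
  refine ⟨c, fun x => ?_⟩
  rw [← hXφ]
  exact (LinearMap.congr_fun (congrArg Subtype.val hc) (φ x)).symm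

/-- The embedding of the centroid of `L` into the base field of a central simple algebra
spanned by `L`. -/
theorem exists_centroid_ringHom [Algebra k K] [IsScalarTower k K B] [Nontrivial L]
    (hB : IsSimpleAlg K B) (hc : IsCentralAlg K B) (hφ : Function.Injective φ)
    (hspan : Submodule.span K (Set.range φ) = ⊤) :
    ∃ ρ : algCentroid k L →+* K, Function.Injective ρ ∧
      (∀ c : k, ρ (algebraMap k _ c) = algebraMap k K c) ∧ ∀ χ x, φ (χ • x) = ρ χ • φ x := by
  choose ρ hρ using exists_centroid_scalar hB hc hspan
  obtain ⟨x, hx⟩ := exists_ne (0 : L)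
  have hφx : φ x ≠ 0 := fun h => hx (hφ (by rw [h, map_zero]))
  -- A scalar is determined by its action on one nonzero vector, so all ring homomorphism laws are
  -- tested at `φ x`.
  have huniq : ∀ c d : K, c • φ x = d • φ x → c = d := fun c d h =>
    smul_left_injective K hφx h
  refine ⟨
    { toFun := ρ
      map_one' := huniq _ _ ?_
      map_zero' := huniq _ _ ?_
      map_mul' := fun χ ψ => huniq _ _ ?_
      map_add' := fun χ ψ => huniq _ _ ?_ }, ?_, fun c => huniq _ _ ?_, hρ⟩
  · rw [← hρ, one_smul, one_smul]
  · rw [← hρ, mul_smul, mul_smul, ← hρ, ← hρ]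
  · rw [← hρ, zero_smul, zero_smul, map_zero]
  · rw [← hρ, add_smul, add_smul, ← hρ, ← hρ, map_add]
  · intro χ ψ h
    refine Subtype.ext (LinearMap.ext fun y => hφ ?_)
    change φ (χ • y) = φ (ψ • y)
    have h : ρ χ = ρ ψ := h
    rw [hρ, hρ, h]
  · change ρ _ • φ x = _
    rw [← hρ, algebraMap_smul, algebraMap_smul, map_smul]

end SpanningEmbedding

/-! ### Existence, uniqueness and transfer of the absolute type -/

section AbsoluteTypeLemmas

/-- A domain over `k` has an algebraic embedding into an algebraically closed field. -/
theorem exists_isAlgClosed_algebra (k R : Type u) [Field k] [CommRing R] [IsDomain R]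
    [Algebra k R] :
    ∃ (K : Type u) (_ : Field K) (_ : IsAlgClosed K) (_ : Algebra k K) (_ : Algebra R K)
      (_ : IsScalarTower k R K), Function.Injective (algebraMap R K) ∧
        Algebra.IsAlgebraic R K := by
  refine ⟨AlgebraicClosure (FractionRing R), inferInstance, inferInstance, inferInstance,
    inferInstance, inferInstance, ?_, ?_⟩
  · rw [IsScalarTower.algebraMap_eq R (FractionRing R) (AlgebraicClosure (FractionRing R))]
    exact (algebraMap (FractionRing R) _).injective.comp (IsFractionRing.injective _ _)
  · exact (IsFractionRing.comap_isAlgebraic_iff (K := FractionRing R)).2 inferInstance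

/-- An algebraic extension of a domain embeds into every algebraically closed one. -/
theorem exists_ringHom_of_isAlgebraic (R S K : Type*) [CommRing R] [IsDomain R] [Field S] [Field K]
    [IsAlgClosed K] [Algebra R S] [Algebra R K] [Algebra.IsAlgebraic R S]
    (hS : Function.Injective (algebraMap R S)) (hK : Function.Injective (algebraMap R K)) :
    ∃ f : S →+* K, ∀ x, f (algebraMap R S x) = algebraMap R K x := by
  have : FaithfulSMul R S := (faithfulSMul_iff_algebraMap_injective _ _).2 hS
  have : FaithfulSMul R K := (faithfulSMul_iff_algebraMap_injective _ _).2 hK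
  let f : S →ₐ[R] K := IsAlgClosed.lift
  exact ⟨f, f.commutes⟩

variable {k : Type u} [Field k]

theorem AlgIso.extendScalars {Z K A X : Type*} (E : Type*) [CommRing Z] [Field K]
    [Field E] [Algebra k K] [Algebra k E] [Algebra K E] [IsScalarTower k K E] [Algebra Z K]
    [Algebra Z E] [IsScalarTower Z K E] [NonUnitalNonAssocRing A] [Module Z A]
    [IsScalarTower Z A A] [SMulCommClass Z A A] [NonUnitalNonAssocRing X] [Module k X]
    [IsScalarTower k X X] [SMulCommClass k X X] (h : AlgIso K (K ⊗[Z] A) (K ⊗[k] X)) :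
    AlgIso E (E ⊗[Z] A) (E ⊗[k] X) :=
  ((algIso_cancelBaseChange Z K E A).symm.trans (h.baseChange E)).trans
    (algIso_cancelBaseChange k K E X)

variable {V : Set (FreeNonUnitalNonAssocAlgebra k ℕ)} {𝕏 : Set (NonAssocAlg k)}

/-- An archetype realizing the type of a prime pfgc algebra over all algebraically closed
extensions of its centroid. -/
theorem IsPrimeAlg.exists_archetype (hV : IsHomogeneousVariety V) (hS : AxiomS V)
    (h𝕏 : IsArchetypeSet V 𝕏) {A : NonAssocAlg k} [IsPfgc k A] (hA : IsPrimeAlg k A)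
    (hVA : IsVAlg V A) :
    ∃ X ∈ 𝕏, ∀ (K : Type u) [Field K] [IsAlgClosed K] [Algebra k K]
      [Algebra (algCentroid k A) K] [IsScalarTower k (algCentroid k A) K],
      Function.Injective (algebraMap (algCentroid k A) K) →
        AlgIso K (K ⊗[algCentroid k A] A) (K ⊗[k] X) := by
  have := hA.isDomain_algCentroid
  have : Module.Finite (algCentroid k A) A := IsPfgc.finite
  obtain ⟨K₀, _, _, _, _, _, hinj₀, _⟩ := exists_isAlgClosed_algebra k (algCentroid k A)
  obtain ⟨hsimple, hcentral⟩ := hA.isSimpleAlg_and_isCentralAlg_centroid K₀ hV hS hVA hinj₀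
  obtain ⟨X, hX, hiso⟩ := h𝕏.exists_iso K₀ (K₀ ⊗[algCentroid k A] A) (hVA.tensorProduct K₀ hV)
    inferInstance hcentral hsimple
  refine ⟨X, hX, ?_⟩
  intro K _ _ _ _ _ hinj
  -- `K₀` is algebraic over the centroid, so it embeds in `K` over the centroid and the isomorphism
  -- found over `K₀` extends to `K`.
  obtain ⟨f, hf⟩ := exists_ringHom_of_isAlgebraic (algCentroid k A) K₀ K hinj₀ hinj
  let _ : Algebra K₀ K := f.toAlgebra
  have : IsScalarTower (algCentroid k A) K₀ K :=
    IsScalarTower.of_algebraMap_eq fun x => (hf x).symm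
  have : IsScalarTower k K₀ K := IsScalarTower.of_algebraMap_eq fun x => by
    rw [IsScalarTower.algebraMap_apply k (algCentroid k A) K,
      IsScalarTower.algebraMap_apply k (algCentroid k A) K₀,
      ← IsScalarTower.algebraMap_apply (algCentroid k A) K₀ K]
  exact hiso.extendScalars K

/-- Testing over a single `K₀` forces `Y = X`. Conversely, (A2) shows that no other archetype
becomes isomorphic to the base change of `A`. -/
theorem isAbsoluteType_iff_eq (h𝕏 : IsArchetypeSet V 𝕏) {A : NonAssocAlg k} [IsPfgc k A]
    (hA : IsPrimeAlg k A) {X : NonAssocAlg k} (hX : X ∈ 𝕏)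
    (h : ∀ (K : Type u) [Field K] [IsAlgClosed K] [Algebra k K]
      [Algebra (algCentroid k A) K] [IsScalarTower k (algCentroid k A) K],
      Function.Injective (algebraMap (algCentroid k A) K) →
        AlgIso K (K ⊗[algCentroid k A] A) (K ⊗[k] X)) (Y : NonAssocAlg k) :
    IsAbsoluteType 𝕏 A Y ↔ Y = X := by
  constructor
  · rintro ⟨hY, hYt⟩
    have := hA.isDomain_algCentroid
    obtain ⟨K₀, _, _, _, _, _, hinj₀, _⟩ := exists_isAlgClosed_algebra k (algCentroid k A)
    exact ((hYt K₀ hinj₀ X hX).1 (h K₀ hinj₀)).symm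
  · rintro rfl
    refine ⟨hX, ?_⟩
    intro K _ _ _ _ _ hinj Z hZ
    constructor
    · intro hiso
      exact h𝕏.eq_of_iso K Z hZ Y hX (hiso.symm.trans (h K hinj))
    · rintro rfl
      exact h K hinj

/-- A central simple algebra that is spanned by an embedded pfgc prime algebra is a base change
of that algebra. -/
theorem algIso_tensorProduct_of_span_eq_top {L : Type u} [NonUnitalNonAssocRing L] [Module k L]
    [IsScalarTower k L L] [SMulCommClass k L L] [IsPfgc k L] {K : Type u} [Field K] [Algebra k K]
    [Algebra (algCentroid k L) K] {B : Type*} [NonUnitalNonAssocRing B] [Module K B]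
    [IsScalarTower K B B] [SMulCommClass K B B] [Module k B] [Nontrivial B]
    (φ : L →ₙₐ[k] B) (hspan : Submodule.span K (Set.range φ) = ⊤)
    (hsmul : ∀ (χ : algCentroid k L) x, φ (χ • x) = algebraMap (algCentroid k L) K χ • φ x)
    (hsimple : IsSimpleAlg K (K ⊗[algCentroid k L] L)) :
    AlgIso K (K ⊗[algCentroid k L] L) B := by
  let _ : Module (algCentroid k L) B := Module.compHom B (algebraMap (algCentroid k L) K)
  have : IsScalarTower (algCentroid k L) K B := ⟨fun χ c b => by
    rw [Algebra.smul_def, mul_smul]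
    rfl⟩
  let ψ : L →ₗ[algCentroid k L] B :=
    { toFun := φ
      map_add' := map_add φ
      map_smul' := hsmul }
  let Φ : K ⊗[algCentroid k L] L →ₗ[K] B := ψ.liftBaseChange K
  have hΦ : ∀ c x, Φ (c ⊗ₜ x) = c • φ x := fun c x => rfl
  have htmul : ∀ a b c d, Φ ((a * c) ⊗ₜ (b * d)) = Φ (a ⊗ₜ b) * Φ (c ⊗ₜ d) := fun a b c d => by
    rw [hΦ, hΦ, hΦ, map_mul, smul_mul_smul_comm]
  have hmul : ∀ x y, Φ (x * y) = Φ x * Φ y := map_mul_of_map_tmul_mul Φ.toAddMonoidHom htmul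
  have hsurj : Function.Surjective Φ := by
    rw [← LinearMap.range_eq_top, eq_top_iff, ← hspan, Submodule.span_le]
    rintro _ ⟨x, rfl⟩
    exact ⟨1 ⊗ₜ x, by rw [hΦ, one_smul]⟩
  have hinj : Function.Injective Φ := by
    rw [← LinearMap.ker_eq_bot]
    -- The kernel is an ideal of a simple algebra, and it is not everything since `Φ` maps onto a
    -- nonzero algebra.
    refine (hsimple.2 _ fun x hx a => ?_).resolve_right fun h => ?_
    · rw [LinearMap.mem_ker] at hx
      rw [LinearMap.mem_ker, LinearMap.mem_ker, hmul, hmul, hx, mul_zero, zero_mul]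
      exact ⟨rfl, rfl⟩
    · obtain ⟨b, hb⟩ := exists_ne (0 : B)
      obtain ⟨x, rfl⟩ := hsurj b
      exact hb (LinearMap.mem_ker.1 (h ▸ Submodule.mem_top))
  exact ⟨LinearEquiv.ofBijective Φ ⟨hinj, hsurj⟩, hmul⟩

/-- A pfgc algebra `L` that embeds as a spanning subalgebra into a base change of `A` has the same
type as `A`, and is a prime algebra of the variety. -/
theorem absoluteType_of_span_eq_top (hV : IsHomogeneousVariety V) (hS : AxiomS V)
    (h𝕏 : IsArchetypeSet V 𝕏) {A L : NonAssocAlg k} [IsPfgc k A] [IsPfgc k L]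
    (hA : IsPrimeAlg k A) (hVA : IsVAlg V A) (K : Type u) [Field K] [IsAlgClosed K] [Algebra k K]
    [Algebra (algCentroid k A) K] [IsScalarTower k (algCentroid k A) K]
    (hinj : Function.Injective (algebraMap (algCentroid k A) K))
    (φ : L →ₙₐ[k] K ⊗[algCentroid k A] A) (hφ : Function.Injective φ)
    (hspan : Submodule.span K (Set.range φ) = ⊤) :
    IsPrimeAlg k L ∧ IsVAlg V L ∧
      ∀ Y : NonAssocAlg k, IsAbsoluteType 𝕏 A Y ↔ IsAbsoluteType 𝕏 L Y := by
  obtain ⟨hsimple, hcentral⟩ := hA.isSimpleAlg_and_isCentralAlg_centroid K hV hS hVA hinj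
  have hprime : IsPrimeAlg k L := hsimple.isPrimeAlg_of_span_eq_top hφ hspan
  have hVL : IsVAlg V L := IsVAlg.of_injective φ hφ (hVA.tensorProduct K hV)
  refine ⟨hprime, hVL, fun Y => ?_⟩
  have : Nontrivial L := IsPfgc.nontrivial (K := k)
  obtain ⟨ρ, hρ, hρk, hρφ⟩ := exists_centroid_ringHom hsimple hcentral hφ hspan
  obtain ⟨X, hX, hXA⟩ := hA.exists_archetype hV hS h𝕏 hVA
  obtain ⟨X', hX', hXL⟩ := hprime.exists_archetype hV hS h𝕏 hVL
  -- `K` now contains both centroids, so the archetypes of `A` and `L` can be compared over the same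
  -- field.
  let _ : Algebra (algCentroid k L) K := ρ.toAlgebra
  have : IsScalarTower k (algCentroid k L) K :=
    IsScalarTower.of_algebraMap_eq fun c => (hρk c).symm
  have : Nontrivial (K ⊗[algCentroid k A] A) := hφ.nontrivial
  have hsimpleL := (hprime.isSimpleAlg_and_isCentralAlg_centroid K hV hS hVL hρ).1
  have hiso := algIso_tensorProduct_of_span_eq_top φ hspan hρφ hsimpleL
  have hXX' : X = X' := h𝕏.eq_of_iso K X hX X' hX'
    ((hXA K hinj).symm.trans (hiso.symm.trans (hXL K hρ)))
  rw [isAbsoluteType_iff_eq h𝕏 hA hX hXA, isAbsoluteType_iff_eq h𝕏 hprime hX' hXL, hXX']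

end AbsoluteTypeLemmas

theorem tmul_T_eq_zero {k A : Type*} [Field k] [AddCommGroup A] [Module k A] {a : A} {n : ℤ}
    (h : a ⊗ₜ[k] (LaurentPolynomial.T n : k[T;T⁻¹]) = 0) :
    a = 0 := by
  have h1 := congrArg
    (fun t => TensorProduct.rid k A (((AddMonoidAlgebra.basis ℤ k).coord n).lTensor A t)) h
  have h2 : (AddMonoidAlgebra.basis ℤ k).repr (LaurentPolynomial.T n) n = 1 := by
    change (AddMonoidAlgebra.basis ℤ k).repr (AddMonoidAlgebra.basis ℤ k n) n = 1
    rw [Module.Basis.repr_self, Finsupp.single_eq_same]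
  simpa [h2] using h1

/-! ### Homogeneous components in a graded algebra -/

section GradedProjections

variable {k : Type*} [Field k] {A : Type*} [NonUnitalNonAssocRing A] [Module k A]
  {m : ℕ} {G : ZMod m → Submodule k A}

/-- The projection onto a homogeneous component. -/
noncomputable def gradedProj (h : DirectSum.IsInternal G) (i : ZMod m) : Module.End k A :=
  (G i).subtype ∘ₗ DirectSum.component k (ZMod m) (fun i => G i) i ∘ₗ
    (LinearEquiv.ofBijective (DirectSum.coeLinearMap G) h).symm.toLinearMap

theorem gradedProj_mem (h : DirectSum.IsInternal G) (i : ZMod m) (x : A) :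
    gradedProj h i x ∈ G i :=
  Subtype.prop _

theorem gradedProj_of_mem (h : DirectSum.IsInternal G) (i : ZMod m) {j : ZMod m} {x : A}
    (hx : x ∈ G j) : gradedProj h i x = if i = j then x else 0 := by
  change (((LinearEquiv.ofBijective (DirectSum.coeLinearMap G) h).symm x i : G i) : A) = _
  split_ifs with hij
  · subst hij
    rw [h.ofBijective_coeLinearMap_of_mem hx]
  · rw [h.ofBijective_coeLinearMap_of_mem_ne (Ne.symm hij) hx]
    rfl

theorem sum_gradedProj [NeZero m] (h : DirectSum.IsInternal G) (x : A) :
    ∑ i, gradedProj h i x = x := by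
  obtain ⟨y, rfl⟩ := h.2 x
  induction y using DirectSum.induction_on with
  | zero => simp
  | add y z hy hz => simp only [map_add, Finset.sum_add_distrib, hy, hz]
  | of i y =>
    have hy : DirectSum.coeAddMonoidHom G (DirectSum.of (fun i => G i) i y) = y :=
      DirectSum.coeAddMonoidHom_of G i y
    rw [hy]
    simp [gradedProj_of_mem h _ y.2]

theorem gradedProj_mul_of_mem_right [NeZero m] (hG : IsAlgGrading G) (a : ZMod m) {j : ZMod m}
    (u : A) {y : A} (hy : y ∈ G j) :
    gradedProj hG.1 (a + j) (u * y) = gradedProj hG.1 a u * y := by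
  conv_lhs => rw [← sum_gradedProj hG.1 u]
  rw [Finset.sum_mul, map_sum, Finset.sum_eq_single a]
  · rw [gradedProj_of_mem hG.1 _ (hG.2 _ _ _ (gradedProj_mem hG.1 a u) _ hy), if_pos rfl]
  · intro b _ hb
    rw [gradedProj_of_mem hG.1 _ (hG.2 _ _ _ (gradedProj_mem hG.1 b u) _ hy), if_neg]
    exact fun h => hb (add_right_cancel h).symm
  · simp

theorem gradedProj_mul_of_mem_left [NeZero m] (hG : IsAlgGrading G) (a : ZMod m) {j : ZMod m}
    {y : A} (u : A) (hy : y ∈ G j) :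
    gradedProj hG.1 (j + a) (y * u) = y * gradedProj hG.1 a u := by
  conv_lhs => rw [← sum_gradedProj hG.1 u]
  rw [Finset.mul_sum, map_sum, Finset.sum_eq_single a]
  · rw [gradedProj_of_mem hG.1 _ (hG.2 _ _ _ hy _ (gradedProj_mem hG.1 a u)), if_pos rfl]
  · intro b _ hb
    rw [gradedProj_of_mem hG.1 _ (hG.2 _ _ _ hy _ (gradedProj_mem hG.1 b u)), if_neg]
    exact fun h => hb (add_left_cancel h).symm
  · simp

variable [NeZero m]

/-- The component of degree `d` of an endomorphism of a graded algebra. -/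
noncomputable def gradedComponent (h : DirectSum.IsInternal G) (χ : Module.End k A)
    (d : ZMod m) : Module.End k A :=
  ∑ i, gradedProj h (i + d) ∘ₗ χ ∘ₗ gradedProj h i

theorem gradedComponent_of_mem (h : DirectSum.IsInternal G) (χ : Module.End k A) (d : ZMod m)
    {i : ZMod m} {x : A} (hx : x ∈ G i) :
    gradedComponent h χ d x = gradedProj h (i + d) (χ x) := by
  simp only [gradedComponent, LinearMap.sum_apply, LinearMap.comp_apply]
  rw [Finset.sum_eq_single i]
  · rw [gradedProj_of_mem h i hx, if_pos rfl]
  · intro j _ hj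
    rw [gradedProj_of_mem h j hx, if_neg hj, map_zero, map_zero]
  · simp

variable [IsScalarTower k A A] [SMulCommClass k A A]

/-- The components of a centroid element are centroid elements. -/
theorem gradedComponent_mem_algCentroid (hG : IsAlgGrading G) {χ : Module.End k A}
    (hχ : χ ∈ algCentroid k A) (d : ZMod m) : gradedComponent hG.1 χ d ∈ algCentroid k A := by
  -- For sums of homogeneous elements both identities hold term by term, since multiplication by a
  -- homogeneous element only shifts the degree of a projection.
  have key : ∀ s t : ZMod m → A, (∀ i, s i ∈ G i) → (∀ i, t i ∈ G i) →
      gradedComponent hG.1 χ d ((∑ i, s i) * ∑ i, t i) =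
        gradedComponent hG.1 χ d (∑ i, s i) * ∑ i, t i ∧
      gradedComponent hG.1 χ d ((∑ i, s i) * ∑ i, t i) =
        (∑ i, s i) * gradedComponent hG.1 χ d (∑ i, t i) := by
    intro s t hs ht
    simp only [Finset.sum_mul_sum, map_sum]
    constructor
    · refine Finset.sum_congr rfl fun i _ => Finset.sum_congr rfl fun j _ => ?_
      rw [gradedComponent_of_mem hG.1 χ d (hs i),
        gradedComponent_of_mem hG.1 χ d (hG.2 _ _ _ (hs i) _ (ht j)), (hχ _ _).1,
        ← gradedProj_mul_of_mem_right hG _ _ (ht j), add_right_comm]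
    · refine Finset.sum_congr rfl fun i _ => Finset.sum_congr rfl fun j _ => ?_
      rw [gradedComponent_of_mem hG.1 χ d (ht j),
        gradedComponent_of_mem hG.1 χ d (hG.2 _ _ _ (hs i) _ (ht j)), (hχ _ _).2,
        ← gradedProj_mul_of_mem_left hG _ _ (hs i), add_assoc]
  intro x y
  have h := key (fun i => gradedProj hG.1 i x) (fun i => gradedProj hG.1 i y)
    (fun i => gradedProj_mem hG.1 i x) (fun i => gradedProj_mem hG.1 i y)
  rwa [sum_gradedProj, sum_gradedProj] at h

end GradedProjections

/-! ### The loop algebra is pfgc -/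

section LoopPfgc

variable {k : Type*} [Field k] {A : Type*} [NonUnitalNonAssocRing A] [Module k A]
  [IsScalarTower k A A] [SMulCommClass k A A]

theorem tensorMap_mem_algCentroid {R : Type*} [CommRing R] [Algebra k R] {χ : Module.End k A}
    (hχ : χ ∈ algCentroid k A) (s : R) :
    TensorProduct.map χ (LinearMap.mulLeft k s) ∈ algCentroid k (A ⊗[k] R) := by
  intro x y
  induction x with
  | zero => simp
  | add x x' hx hx' =>
    simp only [add_mul, map_add]
    exact ⟨by rw [hx.1, hx'.1], by rw [hx.2, hx'.2]⟩
  | tmul a r =>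
    induction y with
    | zero => simp
    | add y y' hy hy' =>
      simp only [mul_add, map_add]
      exact ⟨by rw [hy.1, hy'.1], by rw [hy.2, hy'.2]⟩
    | tmul b t =>
      simp only [Algebra.TensorProduct.tmul_mul_tmul, TensorProduct.map_tmul,
        LinearMap.mulLeft_apply]
      exact ⟨by rw [(hχ a b).1, mul_assoc], by rw [(hχ a b).2, mul_left_comm]⟩

variable {m : ℕ} {G : ZMod m → Submodule k A} (hG : IsAlgGrading G)

/-- The element `x_l ⊗ z^l` of the loop algebra, where `x_l` is the component of `x` of
degree `l` modulo `m`. -/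
noncomputable def loopMonomial (l : ℤ) : A →ₗ[k] loopSubalgebra G hG where
  toFun x := ⟨gradedProj hG.1 (l : ZMod m) x ⊗ₜ LaurentPolynomial.T l,
    Submodule.mem_iSup_of_mem (p := fun i : ℤ => (G (i : ZMod m)).map
      ((TensorProduct.mk k A k[T;T⁻¹]).flip (LaurentPolynomial.T i))) l
      ⟨_, gradedProj_mem hG.1 _ x, rfl⟩⟩
  map_add' x y := Subtype.ext
    (((TensorProduct.mk k A k[T;T⁻¹]).flip (LaurentPolynomial.T l) ∘ₗ
      gradedProj hG.1 (l : ZMod m)).map_add x y)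
  map_smul' c x := Subtype.ext
    (((TensorProduct.mk k A k[T;T⁻¹]).flip (LaurentPolynomial.T l) ∘ₗ
      gradedProj hG.1 (l : ZMod m)).map_smul c x)

theorem coe_loopMonomial (l : ℤ) (x : A) : (loopMonomial hG l x : A ⊗[k] k[T;T⁻¹]) =
    gradedProj hG.1 (l : ZMod m) x ⊗ₜ LaurentPolynomial.T l := rfl

theorem loopSubalgebra_mem_of_forall_loopMonomial {N : AddSubmonoid (loopSubalgebra G hG)}
    (hN : ∀ l x, loopMonomial hG l x ∈ N) (y : loopSubalgebra G hG) : y ∈ N := by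
  obtain ⟨y, hyL⟩ := y
  have hy : y ∈ loopSubmodule G := hyL
  unfold loopSubmodule at hy
  induction hy using Submodule.iSup_induction' with
  | zero => exact N.zero_mem
  | add x y hx hy hx' hy' => exact N.add_mem (hx' hx) (hy' hy)
  | mem l y hy =>
    obtain ⟨x, hx, rfl⟩ := hy
    convert hN l x using 1
    apply Subtype.ext
    rw [coe_loopMonomial, gradedProj_of_mem hG.1 _ hx, if_pos rfl]
    rfl

variable [NeZero m]

/-- The component of degree `n` modulo `m` of a centroid element of `A`, multiplied by `z^n`, as
a centroid element of the loop algebra. -/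
noncomputable def loopCentroid (χ : algCentroid k A) (n : ℤ) :
    algCentroid k (loopSubalgebra G hG) := by
  let Φ := TensorProduct.map (gradedComponent hG.1 χ.1 (n : ZMod m))
    (LinearMap.mulLeft k (LaurentPolynomial.T n : k[T;T⁻¹]))
  have hΦ : Φ ∈ algCentroid k (A ⊗[k] k[T;T⁻¹]) :=
    tensorMap_mem_algCentroid (gradedComponent_mem_algCentroid hG χ.2 _) _
  have hmem : ∀ y ∈ loopSubmodule G, Φ y ∈ loopSubmodule G := by
    intro y hy
    unfold loopSubmodule at hy
    induction hy using Submodule.iSup_induction' with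
    | zero => rw [map_zero]; exact Submodule.zero_mem _
    | add x y _ _ hx hy => rw [map_add]; exact Submodule.add_mem _ hx hy
    | mem l y hy =>
      obtain ⟨x, hx, rfl⟩ := hy
      refine Submodule.mem_iSup_of_mem (n + l) ⟨gradedComponent hG.1 χ.1 (n : ZMod m) x, ?_, ?_⟩
      · rw [gradedComponent_of_mem hG.1 _ _ hx, Int.cast_add, add_comm]
        exact gradedProj_mem _ _ _
      · change _ ⊗ₜ[k] LaurentPolynomial.T (n + l) =
          _ ⊗ₜ[k] (LaurentPolynomial.T n * LaurentPolynomial.T l)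
        rw [LaurentPolynomial.T_add]
  exact ⟨{ toFun := fun y => ⟨Φ y.1, hmem y.1 y.2⟩
           map_add' := fun x y => Subtype.ext (map_add Φ x.1 y.1)
           map_smul' := fun c x => Subtype.ext (map_smul Φ c x.1) },
    fun x y => ⟨Subtype.ext (hΦ x.1 y.1).1, Subtype.ext (hΦ x.1 y.1).2⟩⟩

theorem coe_loopCentroid_smul (χ : algCentroid k A) (n : ℤ) (y : loopSubalgebra G hG) :
    ((loopCentroid hG χ n • y : loopSubalgebra G hG) : A ⊗[k] k[T;T⁻¹]) =
      TensorProduct.map (gradedComponent hG.1 χ.1 (n : ZMod m))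
        (LinearMap.mulLeft k (LaurentPolynomial.T n : k[T;T⁻¹])) y := rfl

/-- The degree `l` part of `χ x` is the sum of the components of `χ` of degree `l - j` applied to
`x_j`. Choosing the representatives `j.val` makes the exponents of `z` add up to `l` exactly, not
only modulo `m`. -/
theorem loopMonomial_centroid_smul (χ : algCentroid k A) (l : ℤ) (x : A) :
    loopMonomial hG l (χ • x) =
      ∑ j : ZMod m, loopCentroid hG χ (l - j.val) • loopMonomial hG (j.val : ℤ) x := by
  apply Subtype.ext
  rw [AddSubmonoidClass.coe_finsetSum]
  simp only [coe_loopCentroid_smul, coe_loopMonomial, TensorProduct.map_tmul,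
    LinearMap.mulLeft_apply, ← LaurentPolynomial.T_add, sub_add_cancel]
  rw [← TensorProduct.sum_tmul]
  congr 1
  conv_lhs => rw [← sum_gradedProj hG.1 x]
  rw [Finset.smul_sum, map_sum]
  refine Finset.sum_congr rfl fun j _ => ?_
  have hj : (((j.val : ℕ) : ℤ) : ZMod m) = j := by simp
  rw [Int.cast_sub, hj, gradedComponent_of_mem hG.1 _ _ (gradedProj_mem hG.1 j x),
    add_sub_cancel]
  rfl

theorem loopMonomial_mul (l : ℤ) (x y : A) :
    loopMonomial hG l (x * y) =
      ∑ j : ZMod m, loopMonomial hG (j.val : ℤ) x * loopMonomial hG (l - j.val) y := by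
  apply Subtype.ext
  rw [AddSubmonoidClass.coe_finsetSum]
  simp only [NonUnitalSubalgebra.coe_mul, coe_loopMonomial, Algebra.TensorProduct.tmul_mul_tmul,
    ← LaurentPolynomial.T_add, add_sub_cancel]
  rw [← TensorProduct.sum_tmul]
  congr 1
  conv_lhs => rw [← sum_gradedProj hG.1 x]
  rw [Finset.sum_mul, map_sum]
  refine Finset.sum_congr rfl fun j _ => ?_
  have hj : (((j.val : ℕ) : ℤ) : ZMod m) = j := by simp
  rw [Int.cast_sub, hj, ← gradedProj_mul_of_mem_left hG _ _ (gradedProj_mem hG.1 j x),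
    add_sub_cancel]

theorem IsPerfectAlg.loopSubalgebra (hA : IsPerfectAlg k A) :
    IsPerfectAlg k (loopSubalgebra G hG) := by
  rw [IsPerfectAlg, eq_top_iff]
  rintro y -
  refine loopSubalgebra_mem_of_forall_loopMonomial hG (N := (Submodule.span k _).toAddSubmonoid)
    (fun l x => ?_) y
  have hx : x ∈ Submodule.span k {z : A | ∃ x y : A, z = x * y} := hA ▸ Submodule.mem_top
  rw [Submodule.mem_toAddSubmonoid]
  induction hx using Submodule.span_induction with
  | zero => rw [map_zero]; exact Submodule.zero_mem _
  | add x y _ _ hx hy => rw [map_add]; exact Submodule.add_mem _ hx hy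
  | smul c x _ hx => rw [map_smul]; exact Submodule.smul_mem _ _ hx
  | mem x hx =>
    obtain ⟨x, y, rfl⟩ := hx
    rw [loopMonomial_mul]
    exact Submodule.sum_mem _ fun j _ => Submodule.subset_span ⟨_, _, rfl⟩

/-- Generators are the monomials of degree `0, …, m - 1` attached to a finite generating set of `A`.
-/
theorem loopSubalgebra_finite (hA : Module.Finite (algCentroid k A) A) :
    Module.Finite (algCentroid k (loopSubalgebra G hG)) (loopSubalgebra G hG) := by
  obtain ⟨S, hS⟩ := hA.fg_top
  let gen : ZMod m × S → loopSubalgebra G hG := fun p => loopMonomial hG (p.1.val : ℤ) p.2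
  refine ⟨Submodule.fg_def.2 ⟨Set.range gen, Set.finite_range gen, ?_⟩⟩
  rw [eq_top_iff]
  rintro y -
  refine loopSubalgebra_mem_of_forall_loopMonomial hG
    (N := (Submodule.span (algCentroid k (loopSubalgebra G hG)) _).toAddSubmonoid)
    (fun l x => ?_) y
  rw [Submodule.mem_toAddSubmonoid]
  have hmem : ∀ x : A, x ∈ Submodule.span (algCentroid k A) (S : Set A) := fun x =>
    hS ▸ Submodule.mem_top
  have hval : ∀ j : ZMod m, loopMonomial hG (j.val : ℤ) x ∈
      Submodule.span (algCentroid k (loopSubalgebra G hG)) (Set.range gen) := by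
    have hx := hmem x
    induction hx using Submodule.span_induction with
    | zero => intro j; rw [map_zero]; exact Submodule.zero_mem _
    | add x y _ _ hx hy => intro j; rw [map_add]; exact Submodule.add_mem _ (hx j) (hy j)
    | mem x hx => exact fun j => Submodule.subset_span ⟨(j, ⟨x, hx⟩), rfl⟩
    | smul χ x _ hx =>
      intro j
      rw [loopMonomial_centroid_smul]
      exact Submodule.sum_mem _ fun i _ => Submodule.smul_mem _ _ (hx i)
  -- Applied to `χ = 1`, the formula moves an arbitrary exponent `l` to the representatives `j.val`
  -- already treated.
  rw [← one_smul (algCentroid k A) x, loopMonomial_centroid_smul]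
  exact Submodule.sum_mem _ fun i _ => Submodule.smul_mem _ _ (hval i)

theorem IsPfgc.loopSubalgebra [IsPfgc k A] : IsPfgc k (loopSubalgebra G hG) where
  perfect := IsPerfectAlg.loopSubalgebra hG IsPfgc.perfect
  finite := loopSubalgebra_finite hG IsPfgc.finite
  nontrivial := by
    have : Nontrivial A := IsPfgc.nontrivial (K := k)
    obtain ⟨x, hx⟩ := exists_ne (0 : A)
    obtain ⟨i, hi⟩ : ∃ i, gradedProj hG.1 i x ≠ 0 := by
      by_contra! h
      exact hx (by rw [← sum_gradedProj hG.1 x]; exact Finset.sum_eq_zero fun i _ => h i)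
    refine ⟨loopMonomial hG (i.val : ℤ) x, 0, fun h => hi ?_⟩
    have h1 := congrArg Subtype.val h
    rw [coe_loopMonomial] at h1
    simpa using tmul_T_eq_zero h1

end LoopPfgc

/-! ### Embedding the loop algebra by evaluation at a transcendental unit -/

section LoopEmbedding

/-- An algebraically closed extension of `F` with a unit `z` whose powers have dual functionals
over `F`. -/
theorem exists_isAlgClosed_unit (F : Type u) [Field F] :
    ∃ (K : Type u) (_ : Field K) (_ : IsAlgClosed K) (_ : Algebra F K) (z : Kˣ),
      ∀ n : ℤ, ∃ f : K →ₗ[F] F, ∀ j : ℤ, f ((z ^ j : Kˣ) : K) = if j = n then 1 else 0 := by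
  obtain ⟨K, _, _, _, _, _, hinj, _⟩ := exists_isAlgClosed_algebra F F[T;T⁻¹]
  let t : F[T;T⁻¹]ˣ :=
    ⟨LaurentPolynomial.T 1, LaurentPolynomial.T (-1), by rw [← LaurentPolynomial.T_add]; simp,
      by rw [← LaurentPolynomial.T_add]; simp⟩
  have ht : ∀ j : ℤ, ((t ^ j : F[T;T⁻¹]ˣ) : F[T;T⁻¹]) = LaurentPolynomial.T j := by
    let τ : Multiplicative ℤ →* F[T;T⁻¹] := AddMonoidAlgebra.of F ℤ
    intro j
    have h1 : τ.toHomUnits (Multiplicative.ofAdd 1) = t := Units.ext rfl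
    have h2 : τ.toHomUnits (Multiplicative.ofAdd j) = t ^ j := by
      rw [← h1, ← map_zpow, ← ofAdd_zsmul, smul_eq_mul, mul_one]
    rw [← h2]
    rfl
  refine ⟨K, inferInstance, inferInstance, inferInstance,
    Units.map (algebraMap F[T;T⁻¹] K).toMonoidHom t, fun n => ?_⟩
  let g : F[T;T⁻¹] →ₗ[F] K := (IsScalarTower.toAlgHom F F[T;T⁻¹] K).toLinearMap
  -- A linear retraction of `K` onto the Laurent polynomials, followed by the `n`-th coefficient, is
  -- the dual functional.
  obtain ⟨h, hh⟩ := g.exists_leftInverse_of_injective (LinearMap.ker_eq_bot.2 hinj)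
  refine ⟨(AddMonoidAlgebra.basis ℤ F).coord n ∘ₗ h, fun j => ?_⟩
  rw [← map_zpow]
  change (AddMonoidAlgebra.basis ℤ F).coord n (h (g ((t ^ j : F[T;T⁻¹]ˣ) : F[T;T⁻¹]))) = _
  rw [← LinearMap.comp_apply h g, hh, LinearMap.id_apply, ht]
  change (AddMonoidAlgebra.basis ℤ F).repr (AddMonoidAlgebra.basis ℤ F j) n = _
  rw [Module.Basis.repr_self, Finsupp.single_apply]

variable {k : Type u} [Field k] {A : Type u} [NonUnitalNonAssocRing A] [Module k A]
  {Z : Type u} [CommRing Z] [Algebra k Z] [Module Z A] [IsScalarTower k Z A]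

/-- Evaluation of the Laurent variable at a unit `z` of `K`, as a map
`A ⊗ k[T;T⁻¹] → K ⊗_Z A`. -/
noncomputable def laurentEval (K : Type u) [Field K] [Algebra k K] [Algebra Z K]
    [IsScalarTower k Z K] (z : Kˣ) : A ⊗[k] k[T;T⁻¹] →ₗ[k] K ⊗[Z] A :=
  let ε : k[T;T⁻¹] →ₐ[k] K :=
    AddMonoidAlgebra.lift k K ℤ ((Units.coeHom K).comp (zpowersHom Kˣ z))
  TensorProduct.lift (LinearMap.mk₂ k (fun a f => ε f ⊗ₜ[Z] a)
    (fun a b f => TensorProduct.tmul_add _ _ _)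
    (fun c a f => by
      rw [← algebraMap_smul Z c a, TensorProduct.tmul_smul, algebraMap_smul])
    (fun a f g => by rw [map_add, TensorProduct.add_tmul])
    (fun c a f => by rw [map_smul, TensorProduct.smul_tmul']))

variable (K : Type u) [Field K] [Algebra k K] [Algebra Z K] [IsScalarTower k Z K] (z : Kˣ)

theorem laurentEval_tmul_T (a : A) (n : ℤ) :
    laurentEval (Z := Z) K z (a ⊗ₜ[k] LaurentPolynomial.T n) = ((z ^ n : Kˣ) : K) ⊗ₜ[Z] a := by
  change AddMonoidAlgebra.lift k K ℤ _ (AddMonoidAlgebra.single n 1) ⊗ₜ[Z] a = _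
  rw [AddMonoidAlgebra.lift_single, one_smul]
  rfl

/-- The functional dual to `z ^ n`, tensored with `A`, recovers `1 ⊗ a_n` in `F ⊗[Z] A` from the
value of `∑ a_n ⊗ T^n`; torsion freeness then detects `a_n`. -/
theorem laurentEval_injective (F : Type u) [Field F] [Algebra Z F] [IsDomain Z]
    [IsFractionRing Z F] [Algebra F K] [IsScalarTower Z F K] [Module.IsTorsionFree Z A]
    (hz : ∀ n : ℤ, ∃ f : K →ₗ[F] F, ∀ j : ℤ, f ((z ^ j : Kˣ) : K) = if j = n then 1 else 0) :
    Function.Injective (laurentEval (k := k) (A := A) (Z := Z) K z) := by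
  classical
  rw [injective_iff_map_eq_zero]
  intro x hx
  let e := TensorProduct.equivFinsuppOfBasisRight (M := A) (AddMonoidAlgebra.basis ℤ k)
  obtain ⟨b, rfl⟩ := e.symm.surjective x
  have hb : e.symm b = b.sum fun n a => a ⊗ₜ[k] LaurentPolynomial.T n :=
    TensorProduct.equivFinsuppOfBasisRight_symm_apply _ b
  suffices b = 0 by rw [this, map_zero]
  ext n
  obtain ⟨f, hf⟩ := hz n
  have h := congrArg ((f.restrictScalars Z).rTensor A) hx
  rw [hb, map_finsuppSum, map_finsuppSum, map_zero, Finsupp.sum,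
    Finset.sum_eq_single n] at h
  · rw [laurentEval_tmul_T, LinearMap.rTensor_tmul, LinearMap.restrictScalars_apply, hf,
      if_pos rfl] at h
    refine fractionTensor_mk_injective (Z := Z) (F := F) ?_
    simpa using h
  · intro j _ hj
    rw [laurentEval_tmul_T, LinearMap.rTensor_tmul, LinearMap.restrictScalars_apply, hf,
      if_neg hj, TensorProduct.zero_tmul]
  · intro hn
    rw [Finsupp.notMem_support_iff.1 hn, TensorProduct.zero_tmul, map_zero, map_zero]

variable [IsScalarTower k A A] [SMulCommClass k A A]

/-- A component `a_i` is recovered over `K` from the value `z ^ i ⊗ a_i` by multiplying with `z ^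
(-i)`. -/
theorem span_laurentEval_loopSubalgebra {m : ℕ} [NeZero m] {G : ZMod m → Submodule k A}
    (hG : IsAlgGrading G) :
    Submodule.span K (Set.range fun y : loopSubalgebra G hG =>
      laurentEval (Z := Z) K z (y : A ⊗[k] k[T;T⁻¹])) = ⊤ := by
  rw [eq_top_iff, ← span_range_mk_eq_top Z A K, Submodule.span_le]
  rintro _ ⟨a, rfl⟩
  rw [← sum_gradedProj hG.1 a, map_sum]
  refine Submodule.sum_mem _ fun i _ => ?_
  have h := Submodule.smul_mem (Submodule.span K (Set.range fun y : loopSubalgebra G hG =>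
      laurentEval (Z := Z) K z (y : A ⊗[k] k[T;T⁻¹]))) ((z ^ (-(i.val : ℤ)) : Kˣ) : K)
    (Submodule.subset_span ⟨loopMonomial hG (i.val : ℤ) a, rfl⟩)
  have hi : (((i.val : ℕ) : ℤ) : ZMod m) = i := by simp
  simp only [coe_loopMonomial] at h
  rw [laurentEval_tmul_T, TensorProduct.smul_tmul', smul_eq_mul, ← Units.val_mul, ← zpow_add,
    neg_add_cancel, zpow_zero, Units.val_one, hi] at h
  exact h

variable [IsScalarTower Z A A] [SMulCommClass Z A A]

theorem laurentEval_mul (x y : A ⊗[k] k[T;T⁻¹]) :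
    laurentEval (Z := Z) K z (x * y) = laurentEval K z x * laurentEval K z y := by
  refine map_mul_of_map_tmul_mul (laurentEval (Z := Z) K z).toAddMonoidHom (fun a f b g => ?_) x y
  change AddMonoidAlgebra.lift k K ℤ _ (f * g) ⊗ₜ[Z] (a * b) =
    (AddMonoidAlgebra.lift k K ℤ _ f ⊗ₜ[Z] a) * (AddMonoidAlgebra.lift k K ℤ _ g ⊗ₜ[Z] b)
  rw [map_mul, Algebra.TensorProduct.tmul_mul_tmul]

/-- The loop algebra embeds as a spanning subalgebra into a base change of `A`. -/
theorem exists_loopSubalgebra_embedding [IsDomain Z] [Module.IsTorsionFree Z A] {m : ℕ}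
    [NeZero m] {G : ZMod m → Submodule k A} (hG : IsAlgGrading G) :
    ∃ (K : Type u) (_ : Field K) (_ : IsAlgClosed K) (_ : Algebra k K) (_ : Algebra Z K)
      (_ : IsScalarTower k Z K), Function.Injective (algebraMap Z K) ∧
        ∃ φ : loopSubalgebra G hG →ₙₐ[k] K ⊗[Z] A, Function.Injective φ ∧
          Submodule.span K (Set.range φ) = ⊤ := by
  obtain ⟨K, _, _, _, z, hz⟩ := exists_isAlgClosed_unit (FractionRing Z)
  let algZ : Algebra Z K :=
    ((algebraMap (FractionRing Z) K).comp (algebraMap Z (FractionRing Z))).toAlgebra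
  let algk : Algebra k K := ((algebraMap Z K).comp (algebraMap k Z)).toAlgebra
  have tower : IsScalarTower k Z K := IsScalarTower.of_algebraMap_eq fun _ => rfl
  have : IsScalarTower Z (FractionRing Z) K := IsScalarTower.of_algebraMap_eq fun _ => rfl
  refine ⟨K, inferInstance, inferInstance, algk, algZ, tower, ?_, ?_⟩
  · exact (algebraMap (FractionRing Z) K).injective.comp (IsFractionRing.injective _ _)
  · refine ⟨{ toFun := fun y => laurentEval K z (y : A ⊗[k] k[T;T⁻¹])
              map_smul' := fun c y => map_smul (laurentEval K z) c (y : A ⊗[k] k[T;T⁻¹])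
              map_zero' := map_zero (laurentEval K z)
              map_add' := fun x y => map_add (laurentEval K z) (x : A ⊗[k] k[T;T⁻¹]) y
              map_mul' := fun x y => laurentEval_mul K z (x : A ⊗[k] k[T;T⁻¹]) y }, ?_, ?_⟩
    · exact fun x y h => Subtype.ext (laurentEval_injective K z (FractionRing Z) hz h)
    · exact span_laurentEval_loopSubalgebra K z hG

end LoopEmbedding

/-! ### Permanence of type -/

section Permanence

variable {k : Type u} [Field k] {V : Set (FreeNonUnitalNonAssocAlgebra k ℕ)}
  {𝕏 : Set (NonAssocAlg k)}

theorem loopAlgebra_permanence (hV : IsHomogeneousVariety V) (hS : AxiomS V)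
    (h𝕏 : IsArchetypeSet V 𝕏) {A : NonAssocAlg k} [IsPfgc k A]
    (hA : IsPrimeAlg k A) (hVA : IsVAlg V A) {m : ℕ} (hm : 0 < m) {G : ZMod m → Submodule k A}
    (hG : IsAlgGrading G) :
    ∃ _ : IsPfgc k (loopAlgebra A G hG), IsPrimeAlg k (loopAlgebra A G hG) ∧
      IsVAlg V (loopAlgebra A G hG) ∧
      ∀ Y : NonAssocAlg k, IsAbsoluteType 𝕏 A Y ↔ IsAbsoluteType 𝕏 (loopAlgebra A G hG) Y := by
  -- Positivity of `m` makes `ZMod m` finite, as needed for the sums over homogeneous components.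
  have : NeZero m := ⟨hm.ne'⟩
  have hL : IsPfgc k (loopAlgebra A G hG) := IsPfgc.loopSubalgebra hG
  have := hA.isDomain_algCentroid
  have := hA.isTorsionFree
  obtain ⟨K, _, _, _, _, _, hinj, φ, hφ, hspan⟩ :=
    exists_loopSubalgebra_embedding (Z := algCentroid k A) hG
  exact ⟨hL, absoluteType_of_span_eq_top (L := loopAlgebra A G hG) hV hS h𝕏 hA hVA K hinj φ hφ
    hspan⟩

end Permanence

theorem theorem8p12 {k : Type u} [Field k]
    (V : Set (FreeNonUnitalNonAssocAlgebra k ℕ)) (hV : IsHomogeneousVariety V) (hS : AxiomS V)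
    (𝕏 : Set (NonAssocAlg k)) (h𝕏 : IsArchetypeSet V 𝕏)
    (n : ℕ) (A L : NonAssocAlg k) (hL : IsIteratedLoopAlgebra n A L)
    [IsPfgc k A] (hprime : IsPrimeAlg k A) (hVA : IsVAlg V A) :
    ∃ _ : IsPfgc k L, IsPrimeAlg k L ∧ IsVAlg V L ∧
      ∃ X ∈ 𝕏, (∀ Y : NonAssocAlg k, IsAbsoluteType 𝕏 A Y ↔ Y = X) ∧
        (∀ Y : NonAssocAlg k, IsAbsoluteType 𝕏 L Y ↔ Y = X) := by
  revert hprime hVA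
  revert ‹IsPfgc k A›
  induction hL with
  | zero A =>
    intro _ hprime hVA
    obtain ⟨X, hX, hXA⟩ := hprime.exists_archetype hV hS h𝕏 hVA
    have h := isAbsoluteType_iff_eq h𝕏 hprime hX hXA
    exact ⟨inferInstance, hprime, hVA, X, hX, h, h⟩
  | succ _ hm G hG ih =>
    intro _ hprime hVA
    obtain ⟨_, hprimeL, hVL, X, hX, hXA, hXL⟩ := ih hprime hVA
    obtain ⟨hpfgc, hprime', hV', hiff⟩ := loopAlgebra_permanence hV hS h𝕏 hprimeL hVL hm hG
    exact ⟨hpfgc, hprime', hV', X, hX, hXA, fun Y => (hiff Y).symm.trans (hXL Y)⟩
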